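/- **Setting.** $\mathcal A,\mathcal B,\mathcal C$ denote finite alphabets, $\mathcal A^*$ is the free monoid of words over $\mathcal A$, and $\mathcal A^{\mathbb Z}$ is the space of bi-infinite words $\mathbf x=(x_n)_{n\in\mathbb Z}$ with the product topology and the shift $T$, $(T\mathbf x)_n=x_{n+1}$. For $w\in\mathcal A^*$ the cylinder $[w]$ is the set of all $\mathbf x$ with $x_1\cdots x_{|w|}=w$. A *subshift* is a non-empty closed set $X\subseteq\mathcal A^{\mathbb Z}$ with $T(X)=X$; $\mathcal L(X)$ is the set of all finite factors of elements of $X$. A monoid morphism $\sigma:\mathcal A^*\to\mathcal B^*$ is *non-erasing* if no letter is mapped to the empty word. For such $\sigma$ and a subshift $X$, the *image subshift* $\sigma(X)\subseteq\mathcal B^{\mathbb Z}$ consists of all $\mathbf y$ such that every finite factor of $\mathbf y$ is a factor of some word $\sigma(w)$ with $w\in\mathcal L(X)$. $\mathcal M(X)$ denotes the cone of all finite Borel measures on $\mathcal A^{\mathbb Z}$ (the zero measure included) that are $T$-invariant and have support contained in $X$, equipped with the weak$^*$-topology. **Measure transfer.** Let $\sigma:\mathcal A^*\to\mathcal B^*$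 be non-erasing. Put $\ell(a)=|\sigma(a)|$, let $\mathcal A_\sigma=\{a(k): a\in\mathcal A,\ 1\le k\le \ell(a)\}$, let $\pi_\sigma:\mathcal A^*\to\mathcal A_\sigma^*$ be the morphism $a\mapsto a(1)\cdots a(\ell(a))$, and let $\alpha_\sigma:\mathcal A_\sigma^{\mathbb Z}\to\mathcal B^{\mathbb Z}$ be the map that replaces each letter $a(k)$ by the $k$-th letter of $\sigma(a)$. For $\mu\in\mathcal M(\mathcal A^{\mathbb Z})$ let $\mu_\ell$ be the $T$-invariant finite Borel measure on $\mathcal A_\sigma^{\mathbb Z}$ with $\mu_\ell([u])=\mu([\widehat u])$ for every non-empty $u\in\mathcal A_\sigma^*$, where $\widehat u\in\mathcal A^*$ is the shortest word such that $\pi_\sigma(\widehat u)$ contains $u$ as a factor, and $\mu_\ell([u])=0$ if there is no such word. The *transferred measure* is the push-forward $\sigma^{\mathcal M}(\mu):=(\alpha_\sigma)_*(\mu_\ell)$ on $\mathcal B^{\mathbb Z}$. **Proposition 1.3.** Let $\sigma:\mathcal A^*\to\mathcal B^*$ be any non-erasing morphism and let $X\subseteq\mathcal A^{\mathbb Z}$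 be any subshift. For every $\mu\in\mathcal M(\mathcal A^{\mathbb Z})$ the measure $\mu_\ell$ above exists and is unique, the set $\sigma(X)$ is a subshift over $\mathcal B$, and the measure transfer $\sigma^{\mathcal M}$ restricts to a well-defined map $$\sigma_X^{\mathcal M}:\mathcal M(X)\to\mathcal M(\sigma(X)),\qquad \mu\mapsto\sigma^{\mathcal M}(\mu),$$ which has the following properties: 1. $\sigma_X^{\mathcal M}$ is $\mathbb R_{\ge0}$-linear. 2. $\sigma_X^{\mathcal M}$ is continuous for the weak$^*$-topologies. 3. $\sigma_X^{\mathcal M}$ is surjective. 4. $\sigma_X^{\mathcal M}$ is functorial: for every non-erasing morphism $\sigma':\mathcal B^*\to\mathcal C^*$ one has $(\sigma'\circ\sigma)(X)=\sigma'(\sigma(X))$ and $(\sigma'\circ\sigma)_X^{\mathcal M}={\sigma'}_{\sigma(X)}^{\mathcal M}\circ\sigma_X^{\mathcal M}$. 5. If a subshift $X'\subseteq X$ is the support of a measure $\mu\in\mathcal M(X)$, then $\sigma(X')$ is the support of $\sigma_X^{\mathcal M}(\mu)$. -/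

import Mathlib

open MeasureTheory SymbolicDynamics.FullShift
open scoped NNReal

namespace MeasureTransfer

/-! ### Words, bi-infinite words and subshifts

An alphabet is a finite discrete type `A` with the discrete `σ`-algebra. Words are elements of
`FreeMonoid A`, bi-infinite words are functions `ℤ → A` with the product topology (and the product
`σ`-algebra, which is the Borel `σ`-algebra), and the shift operator is `shift (1 : ℤ)`, that is
`(T x) k = x (1 + k)`. -/

/-- The word `u` is a factor (contiguous subword) of the word `v`. -/
def IsFactor {A : Type*} (u v : FreeMonoid A) : Prop :=
  FreeMonoid.toList u <:+: FreeMonoid.toList v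

/-- The word `w` is read in the bi-infinite word `x`, starting at position `k`. -/
def OccursAt {A : Type*} (w : FreeMonoid A) (x : ℤ → A) (k : ℤ) : Prop :=
  ∀ (i : ℕ) (hi : i < (FreeMonoid.toList w).length), x (k + i) = (FreeMonoid.toList w)[i]

/-- The cylinder `[w]`: all `x` whose positive half-word `x₁ x₂ …` has prefix `w`. -/
def cylinder {A : Type*} (w : FreeMonoid A) : Set (ℤ → A) :=
  {x | OccursAt w x 1}

/-- The language of a set of bi-infinite words: all their finite factors. -/
def language {A : Type*} (X : Set (ℤ → A)) : Set (FreeMonoid A) :=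
  {w | ∃ x ∈ X, ∃ k : ℤ, OccursAt w x k}

/-- The set of bi-infinite words generated by a language `L`: all `y` such that each finite factor
of `y` is a factor of some word in `L`. -/
def generatedBy {A : Type*} (L : Set (FreeMonoid A)) : Set (ℤ → A) :=
  {y | ∀ (u : FreeMonoid A) (k : ℤ), OccursAt u y k → ∃ v ∈ L, IsFactor u v}

/-- A subshift is a non-empty closed set `X` with `T(X) = X`. -/
structure IsSubshift {A : Type*} [TopologicalSpace A] (X : Set (ℤ → A)) : Prop where
  nonempty : X.Nonempty
  isClosed : IsClosed X
  image_shift : shift (1 : ℤ) '' X = X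

/-- A monoid morphism of free monoids is non-erasing if no letter is mapped to the empty word. -/
def NonErasing {A B : Type*} (σ : FreeMonoid A →* FreeMonoid B) : Prop :=
  ∀ a : A, σ (FreeMonoid.of a) ≠ 1

/-- The image subshift `σ(X)`: the subshift generated by the language `σ(L(X))`. -/
def imageSubshift {A B : Type*} (σ : FreeMonoid A →* FreeMonoid B) (X : Set (ℤ → A)) :
    Set (ℤ → B) :=
  generatedBy (σ '' language X)

/-! ### Invariant measures -/

/-- The cone `M(X)` of invariant measures on `X`: all finite Borel measures on `A^ℤ` which are
preserved by the shift operator and have support contained in `X`. It carries the subspace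
topology of the weak-* topology on finite measures. -/
def invariantMeasures {A : Type*} [TopologicalSpace A] [MeasurableSpace A] (X : Set (ℤ → A)) :
    Submodule ℝ≥0 (FiniteMeasure (ℤ → A)) where
  carrier := {μ | MeasurePreserving (shift (1 : ℤ)) (μ : Measure (ℤ → A)) (μ : Measure (ℤ → A)) ∧
    (μ : Measure (ℤ → A)).support ⊆ X}
  add_mem' := by
    rintro μ ν ⟨hμ, hμX⟩ ⟨hν, hνX⟩
    refine ⟨⟨hμ.measurable, ?_⟩, ?_⟩
    · rw [FiniteMeasure.toMeasure_add, Measure.map_add _ _ hμ.measurable, hμ.map_eq, hν.map_eq]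
    · rw [FiniteMeasure.toMeasure_add, Measure.support_add]
      exact Set.union_subset hμX hνX
  zero_mem' := by
    refine ⟨⟨?_, ?_⟩, ?_⟩
    · exact measurable_pi_lambda _ fun k => measurable_pi_apply _
    · simp
    · simp
  smul_mem' := by
    rintro c μ ⟨hμ, hμX⟩
    refine ⟨⟨hμ.measurable, ?_⟩, ?_⟩
    · rw [FiniteMeasure.toMeasure_smul, Measure.map_smul, hμ.map_eq]
    · rw [FiniteMeasure.toMeasure_smul]
      exact (Measure.AbsolutelyContinuous.support_mono
        (Measure.smul_absolutelyContinuous (c := c))).trans hμX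

/-- `ν` is an invariant measure on the full shift whose value on the cylinder of each non-empty
word `w` is the prescribed weight `ω w`. -/
def HasWeights {A : Type*} [TopologicalSpace A] [MeasurableSpace A] (ω : FreeMonoid A → ℝ≥0)
    (ν : FiniteMeasure (ℤ → A)) : Prop :=
  ν ∈ invariantMeasures (Set.univ : Set (ℤ → A)) ∧
    ∀ w : FreeMonoid A, w ≠ 1 → ν (cylinder w) = ω w

open Classical in
/-- The invariant measure on the full shift defined by a weight function `ω`. (It exists, and is
then unique, if `ω` satisfies the Kirchhoff equalities on non-empty words; the value is `0` by
convention for functions `ω` for which there is no such measure.) -/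
noncomputable def measureOfWeights {A : Type*} [TopologicalSpace A] [MeasurableSpace A]
    (ω : FreeMonoid A → ℝ≥0) : FiniteMeasure (ℤ → A) :=
  if h : ∃ ν : FiniteMeasure (ℤ → A), HasWeights ω ν then h.choose else 0

/-! ### Subdivision morphisms and subdivision measures -/

/-- The subdivision alphabet `A_ℓ` with letters `a(k)`, for `a ∈ A` and `k` among the `ℓ a`
subdivision indices (numbered from `0` here). -/
abbrev SubdivisionAlphabet {A : Type*} (ℓ : A → ℕ) : Type _ :=
  Σ a : A, Fin (ℓ a)

instance instDiscreteMeasurableSpaceSubdivision {A : Type*} [MeasurableSpace A] (ℓ : A → ℕ) :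
    DiscreteMeasurableSpace (SubdivisionAlphabet ℓ) where
  forall_measurableSet s := by
    refine MeasurableSpace.measurableSet_iInf.2 fun a => ?_
    change MeasurableSet (Sigma.mk a ⁻¹' s)
    exact MeasurableSet.of_discrete

/-- The subdivision morphism `π_ℓ`, which maps a letter `a` to the word `a(1) a(2) … a(ℓ a)`. -/
def subdivision {A : Type*} (ℓ : A → ℕ) : FreeMonoid A →* FreeMonoid (SubdivisionAlphabet ℓ) :=
  FreeMonoid.lift fun a => FreeMonoid.ofList (List.ofFn fun k : Fin (ℓ a) => ⟨a, k⟩)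

/-- `v` is a shortest word in `A*` such that `π_ℓ(v)` contains `u` as a factor. -/
def IsHat {A : Type*} (ℓ : A → ℕ) (u : FreeMonoid (SubdivisionAlphabet ℓ)) (v : FreeMonoid A) :
    Prop :=
  IsFactor u (subdivision ℓ v) ∧
    ∀ v' : FreeMonoid A, IsFactor u (subdivision ℓ v') → v.length ≤ v'.length

open Classical in
/-- The weight function `μ_ℓ` on `A_ℓ*`: its value on `u` is `μ([û])`, where `û` is the shortest
word such that `π_ℓ(û)` contains `u` as a factor, and `0` if there is no such word. -/
noncomputable def subdivisionWeight {A : Type*} [MeasurableSpace A] (ℓ : A → ℕ)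
    (μ : FiniteMeasure (ℤ → A)) (u : FreeMonoid (SubdivisionAlphabet ℓ)) : ℝ≥0 :=
  if h : ∃ v : FreeMonoid A, IsHat ℓ u v then μ (cylinder h.choose) else 0

/-- The subdivision measure on `A_ℓ^ℤ` defined by an invariant measure `μ` on `A^ℤ`. -/
noncomputable def subdivisionMeasure {A : Type*} [TopologicalSpace A] [MeasurableSpace A]
    (ℓ : A → ℕ) (μ : FiniteMeasure (ℤ → A)) : FiniteMeasure (ℤ → SubdivisionAlphabet ℓ) :=
  measureOfWeights (subdivisionWeight ℓ μ)

/-! ### The measure transfer -/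

/-- The subdivision length function `a ↦ |σ(a)|` of a morphism `σ`. -/
def lengthFn {A B : Type*} (σ : FreeMonoid A →* FreeMonoid B) (a : A) : ℕ :=
  (FreeMonoid.toList (σ (FreeMonoid.of a))).length

/-- The map on letters, `a(k) ↦ σ(a)ₖ`, that induces the letter-to-letter morphism `α_σ`. -/
def letterMap {A B : Type*} (σ : FreeMonoid A →* FreeMonoid B) :
    SubdivisionAlphabet (lengthFn σ) → B :=
  fun c => (FreeMonoid.toList (σ (FreeMonoid.of c.1))).get c.2

/-- The canonical decomposition `σ = α_σ ∘ π_σ`. -/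
theorem map_letterMap_comp_subdivision {A B : Type*} (σ : FreeMonoid A →* FreeMonoid B) :
    (FreeMonoid.map (letterMap σ)).comp (subdivision (lengthFn σ)) = σ := by
  refine FreeMonoid.hom_eq fun a => ?_
  apply FreeMonoid.toList.injective
  simp only [MonoidHom.comp_apply, subdivision, FreeMonoid.lift_eval_of, FreeMonoid.toList_map,
    FreeMonoid.toList_ofList, List.map_ofFn]
  exact List.ofFn_get _

/-- The measure transfer `σ^M`, which maps an invariant measure `μ` on `A^ℤ` to the push-forward
`(α_σ)_*(μ_ℓ)` of its subdivision measure, where `ℓ(a) = |σ(a)|`. -/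
noncomputable def measureTransfer {A B : Type*} [TopologicalSpace A] [MeasurableSpace A]
    [MeasurableSpace B] (σ : FreeMonoid A →* FreeMonoid B) (μ : FiniteMeasure (ℤ → A)) :
    FiniteMeasure (ℤ → B) :=
  (subdivisionMeasure (lengthFn σ) μ).map fun x n => letterMap σ (x n)

end MeasureTransfer

namespace MeasureTransfer

/-! ### Occurrences of words -/

section Occurrences

variable {A : Type*}

/-! The proof trades weights on cylinders for an integral formula. Let `imageWord hσ x`, written
σ(x), be the bi-infinite image of x with the image of x₀ starting at 0. The measure `transferMeasure
hσ μ` is characterised by ∫ f dν = ∫ S f dμ, where the block sum S f(x) adds f(T^k σ(x)) over 0 ≤ k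
< |σ(x₀)|. This is the tower of height |σ(x₀)| over the shift, pushed to B^ℤ.

Most properties become properties of S. It is additive and preserves continuity, because |σ(x₀)| is
locally constant; block sums compose along σ'∘σ; replacing f by f∘T changes S f by the coboundary
f(σ(Tx)) − f(σ(x)), which has integral zero for invariant μ. The support is the set of all shifts of
images of points of supp μ, and this set is the image subshift by compactness.

To identify this measure with the defined one, consider first the subdivision morphism
(`hasWeights_transfer_subdivision`). A letter a(k) reveals its block and its place in it, so u is
read in the subdivision of x from the block of x₀ for at most one offset, and this happens exactly
when x reads û at 0. Thus S maps the indicator of u to that of û. Applying `letterMap` then turns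
subdivided words into images under σ (`measureTransfer_eq_transfer`).

Surjectivity (`exists_transfer_eq`) is a duality argument and needs no recognizability of σ. Given ν
on σ(X), assign ∫ f dν to each function S f + (h∘T − h). If such a function is non-negative on X,
telescoping bounds the Birkhoff sums of f on σ(X) below uniformly, and invariance of ν forces ∫ f dν
≥ 0. The M. Riesz extension theorem and Riesz–Markov–Kakutani give a measure μ: coboundaries
integrate to zero, so μ is invariant; positivity is tested on X only, so μ lives on X; and S f has
integral ∫ f dν, so μ transfers to ν. -/

theorem occursAt_one (x : ℤ → A) (k : ℤ) : OccursAt 1 x k := by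
  intro i hi
  simp at hi

theorem occursAt_of {a : A} {x : ℤ → A} {k : ℤ} : OccursAt (FreeMonoid.of a) x k ↔ x k = a := by
  constructor
  · intro h
    simpa using h 0 (by simp)
  · intro h i hi
    have hi' : i = 0 := by simpa using hi
    subst hi'
    simpa using h

theorem occursAt_mul {v w : FreeMonoid A} {x : ℤ → A} {k : ℤ} :
    OccursAt (v * w) x k ↔ OccursAt v x k ∧ OccursAt w x (k + v.length) := by
  constructor
  · intro h
    refine ⟨fun i hi => ?_, fun i hi => ?_⟩
    · have := h i (by simp only [FreeMonoid.toList_mul, List.length_append]; omega)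
      simp only [FreeMonoid.toList_mul] at this
      rw [this, List.getElem_append_left hi]
    · have := h (v.length + i) (by
        simp only [FreeMonoid.toList_mul, List.length_append, FreeMonoid.length]; omega)
      simp only [FreeMonoid.toList_mul] at this
      rw [List.getElem_append_right (by simp [FreeMonoid.length])] at this
      rw [show k + (v.length : ℤ) + i = k + ((v.length + i : ℕ) : ℤ) by push_cast; ring, this]
      congr 1
      simp [FreeMonoid.length]
  · rintro ⟨h1, h2⟩ i hi
    simp only [FreeMonoid.toList_mul]
    by_cases hv : i < (FreeMonoid.toList v).length
    · rw [List.getElem_append_left hv]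
      exact h1 i hv
    · rw [List.getElem_append_right (by omega)]
      have := h2 (i - v.length) (by
        simp only [FreeMonoid.toList_mul, List.length_append, FreeMonoid.length] at hi ⊢; omega)
      rw [show k + (v.length : ℤ) + ((i - v.length : ℕ) : ℤ) = k + i by
        simp only [FreeMonoid.length]; omega] at this
      exact this

theorem occursAt_shift {w : FreeMonoid A} {x : ℤ → A} {m k : ℤ} :
    OccursAt w (shift m x) k ↔ OccursAt w x (m + k) := by
  simp only [OccursAt, shift_apply, add_assoc]

theorem OccursAt.congr {w : FreeMonoid A} {x y : ℤ → A} {k l : ℤ} (h : OccursAt w x k)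
    (hxy : ∀ i : ℕ, i < w.length → y (l + i) = x (k + i)) : OccursAt w y l :=
  fun i hi => (hxy i hi).trans (h i hi)

theorem OccursAt.apply_eq {w : FreeMonoid A} {x y : ℤ → A} {k l : ℤ} (hx : OccursAt w x k)
    (hy : OccursAt w y l) {i : ℕ} (hi : i < w.length) : x (k + i) = y (l + i) :=
  (hx i hi).trans (hy i hi).symm

/-- The word of length `n` read in `x` from position `k`. -/
def wordAt (x : ℤ → A) (k : ℤ) (n : ℕ) : FreeMonoid A :=
  FreeMonoid.ofList (List.ofFn fun i : Fin n => x (k + i))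

@[simp] theorem length_wordAt (x : ℤ → A) (k : ℤ) (n : ℕ) : (wordAt x k n).length = n := by
  simp [wordAt, FreeMonoid.length]

theorem occursAt_wordAt (x : ℤ → A) (k : ℤ) (n : ℕ) : OccursAt (wordAt x k n) x k := by
  intro i hi
  simp [wordAt]

theorem occursAt_wordAt_iff {x y : ℤ → A} {k l : ℤ} {n : ℕ} :
    OccursAt (wordAt x k n) y l ↔ ∀ i : ℕ, i < n → y (l + i) = x (k + i) := by
  constructor
  · intro h i hi
    exact h.apply_eq (occursAt_wordAt x k n) (by simpa using hi)
  · intro h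
    exact (occursAt_wordAt x k n).congr (by simpa using h)

theorem OccursAt.exists_of_isFactor {u v : FreeMonoid A} {x : ℤ → A} {k : ℤ}
    (h : OccursAt v x k) (huv : IsFactor u v) :
    ∃ i : ℕ, i + u.length ≤ v.length ∧ OccursAt u x (k + i) := by
  obtain ⟨p, s, hps⟩ := huv
  have hv : v = FreeMonoid.ofList p * u * FreeMonoid.ofList s := by
    apply FreeMonoid.toList.injective
    simp [← hps]
  subst hv
  rw [occursAt_mul, occursAt_mul] at h
  refine ⟨p.length, ?_, h.1.2⟩
  simp [FreeMonoid.length]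

theorem OccursAt.isFactor {u v : FreeMonoid A} {x : ℤ → A} {k : ℤ} (h : OccursAt v x k) {i : ℕ}
    (hu : OccursAt u x (k + i)) (hi : i + u.length ≤ v.length) : IsFactor u v := by
  rw [IsFactor, List.infix_iff_getElem?]
  refine ⟨i, ?_, fun j hj => ?_⟩
  · simp only [FreeMonoid.length] at hi; omega
  · have hij : j + i < (FreeMonoid.toList v).length := by
      simp only [FreeMonoid.length] at hi; omega
    rw [List.getElem?_eq_getElem hij, ← h (j + i) hij, ← hu j hj]
    congr 2
    push_cast
    ring

theorem exists_occursAt [Nonempty A] (w : FreeMonoid A) (k : ℤ) : ∃ x : ℤ → A, OccursAt w x k := by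
  classical
  refine ⟨fun p => if h : (p - k).toNat < (FreeMonoid.toList w).length
    then (FreeMonoid.toList w)[(p - k).toNat] else Classical.arbitrary A, fun i hi => ?_⟩
  have : (k + (i : ℤ) - k).toNat = i := by simp
  simp only [this, hi, dite_true]

end Occurrences

/-! ### Block positions -/

section BlockStart

variable {A : Type*} (ℓ : A → ℕ)

/-- The position of the block of `x n` in the bi-infinite word obtained from `x` by replacing
every letter `a` by a block of length `ℓ a`, the block of `x 0` having position `0`. -/
noncomputable def blockStart (x : ℤ → A) (n : ℤ) : ℤ :=
  ∑ i ∈ Finset.Ico 0 n, (ℓ (x i) : ℤ) - ∑ i ∈ Finset.Ico n 0, (ℓ (x i) : ℤ)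

@[simp] theorem blockStart_zero (x : ℤ → A) : blockStart ℓ x 0 = 0 := by simp [blockStart]

theorem blockStart_add_one (x : ℤ → A) (n : ℤ) :
    blockStart ℓ x (n + 1) = blockStart ℓ x n + ℓ (x n) := by
  unfold blockStart
  rcases le_or_gt 0 n with h | h
  · rw [Finset.Ico_eq_empty (a := n + 1) (by omega), Finset.Ico_eq_empty (a := n) (by omega),
      ← Finset.insert_Ico_right_eq_Ico_add_one h, Finset.sum_insert (by simp)]
    simp
    ring
  · rw [Finset.Ico_eq_empty (b := n + 1) (by omega), Finset.Ico_eq_empty (b := n) (by omega),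
      ← Finset.insert_Ico_add_one_left_eq_Ico h, Finset.sum_insert (by simp)]
    simp

theorem blockStart_one (x : ℤ → A) : blockStart ℓ x 1 = ℓ (x 0) := by
  simpa using blockStart_add_one ℓ x 0

/-- The recursion can be run in both directions from 0. Later formulas for block positions are
checked against it instead of manipulating the two sums. -/
theorem blockStart_unique {x : ℤ → A} {g : ℤ → ℤ} (h0 : g 0 = 0)
    (h : ∀ n, g (n + 1) = g n + ℓ (x n)) (n : ℤ) : g n = blockStart ℓ x n := by
  induction n using Int.induction_on with
  | zero => simpa using h0
  | succ n ih => rw [h, ih, blockStart_add_one]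
  | pred n ih =>
    have h1 := h (-n - 1)
    have h2 := blockStart_add_one ℓ x (-n - 1)
    rw [sub_add_cancel] at h1 h2
    omega

theorem blockStart_shift (x : ℤ → A) (j n : ℤ) :
    blockStart ℓ (shift j x) n = blockStart ℓ x (j + n) - blockStart ℓ x j := by
  refine (blockStart_unique ℓ (g := fun n => blockStart ℓ x (j + n) - blockStart ℓ x j) ?_ ?_ n).symm
  · simp
  · intro n
    rw [← add_assoc, blockStart_add_one, shift_apply]
    ring

variable {ℓ}

theorem blockStart_strictMono (hℓ : ∀ a, 0 < ℓ a) (x : ℤ → A) : StrictMono (blockStart ℓ x) :=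
  strictMono_int_of_lt_succ fun n => by
    rw [blockStart_add_one]
    have := hℓ (x n)
    omega

theorem sub_le_blockStart_sub (hℓ : ∀ a, 0 < ℓ a) (x : ℤ → A) {m n : ℤ} (h : m ≤ n) :
    n - m ≤ blockStart ℓ x n - blockStart ℓ x m := by
  induction n, h using Int.leInduction with
  | base => simp
  | succ n _ ih =>
    rw [blockStart_add_one]
    have := hℓ (x n)
    omega

/-- Blocks have length at least one, so block positions are unbounded in both directions; the
required n is the last block starting at or before p. -/
theorem exists_block (hℓ : ∀ a, 0 < ℓ a) (x : ℤ → A) (p : ℤ) :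
    ∃ n, blockStart ℓ x n ≤ p ∧ p < blockStart ℓ x (n + 1) := by
  have hbdd : ∃ b, ∀ z, blockStart ℓ x z ≤ p → z ≤ b := by
    refine ⟨max 0 p, fun z hz => ?_⟩
    by_contra! hlt
    have := sub_le_blockStart_sub hℓ x (m := 0) (n := z) (by omega)
    simp only [blockStart_zero] at this
    omega
  have hinh : ∃ z, blockStart ℓ x z ≤ p := by
    refine ⟨min 0 p, ?_⟩
    have := sub_le_blockStart_sub hℓ x (m := min 0 p) (n := 0) (by omega)
    simp only [blockStart_zero] at this
    omega
  obtain ⟨n, hn, hmax⟩ := Int.exists_greatest_of_bdd hbdd hinh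
  refine ⟨n, hn, not_le.1 fun h => ?_⟩
  have := hmax _ h
  omega

theorem block_unique (hℓ : ∀ a, 0 < ℓ a) {x : ℤ → A} {p m n : ℤ} (hm : blockStart ℓ x m ≤ p)
    (hm' : p < blockStart ℓ x (m + 1)) (hn : blockStart ℓ x n ≤ p)
    (hn' : p < blockStart ℓ x (n + 1)) : m = n := by
  have h1 := (blockStart_strictMono hℓ x).lt_iff_lt.1 (hm.trans_lt hn')
  have h2 := (blockStart_strictMono hℓ x).lt_iff_lt.1 (hn.trans_lt hm')
  omega

end BlockStart

/-! ### The image of a bi-infinite word -/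

section ImageWord

variable {A B C : Type*} {σ : FreeMonoid A →* FreeMonoid B}

theorem NonErasing.lengthFn_pos (hσ : NonErasing σ) (a : A) : 0 < lengthFn σ a :=
  List.length_pos_iff.2 (hσ a)

theorem length_map_of (σ : FreeMonoid A →* FreeMonoid B) (a : A) :
    (σ (FreeMonoid.of a)).length = lengthFn σ a := rfl

variable (hσ : NonErasing σ)

/-- The bi-infinite word obtained from `x` by replacing every letter `a` by the word `σ a`, the
image of `x 0` having position `0`. -/
noncomputable def imageWord (x : ℤ → A) (p : ℤ) : B :=
  (FreeMonoid.toList (σ (FreeMonoid.of (x (exists_block hσ.lengthFn_pos x p).choose)))).get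
    ⟨(p - blockStart (lengthFn σ) x (exists_block hσ.lengthFn_pos x p).choose).toNat, by
      have h := (exists_block hσ.lengthFn_pos x p).choose_spec
      rw [blockStart_add_one] at h
      simp only [lengthFn] at h ⊢
      omega⟩

theorem occursAt_imageWord_of (x : ℤ → A) (n : ℤ) :
    OccursAt (σ (FreeMonoid.of (x n))) (imageWord hσ x) (blockStart (lengthFn σ) x n) := by
  intro i hi
  -- The chosen block index also occurs in the bound carried by `get`, so it is replaced by a free
  -- variable m before being identified with n.
  have key : ∀ m, m = n → ∀ h, (FreeMonoid.toList (σ (FreeMonoid.of (x m)))).get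
      ⟨(blockStart (lengthFn σ) x n + i - blockStart (lengthFn σ) x m).toNat, h⟩ =
        (FreeMonoid.toList (σ (FreeMonoid.of (x n))))[i] := by
    rintro m rfl h
    simp
  have h := (exists_block hσ.lengthFn_pos x (blockStart (lengthFn σ) x n + i)).choose_spec
  refine key _ (block_unique hσ.lengthFn_pos h.1 h.2 (by omega) ?_) _
  rw [blockStart_add_one]
  simp only [lengthFn]
  omega

/-- The blocks cover ℤ, so reading the right word in every block is enough. Compatibility with
shifts, composition and `letterMap` is deduced from this. -/
theorem imageWord_unique {x : ℤ → A} {y : ℤ → B}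
    (h : ∀ n, OccursAt (σ (FreeMonoid.of (x n))) y (blockStart (lengthFn σ) x n)) :
    y = imageWord hσ x := by
  funext p
  obtain ⟨n, hn, hn'⟩ := exists_block hσ.lengthFn_pos x p
  rw [blockStart_add_one] at hn'
  have := (h n).apply_eq (occursAt_imageWord_of hσ x n)
    (i := (p - blockStart (lengthFn σ) x n).toNat) (by rw [length_map_of]; omega)
  rwa [Int.toNat_of_nonneg (by omega), add_sub_cancel] at this

theorem blockStart_add_length (σ : FreeMonoid A →* FreeMonoid B) {w : FreeMonoid A} {x : ℤ → A}
    {k : ℤ} (h : OccursAt w x k) :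
    blockStart (lengthFn σ) x (k + w.length) = blockStart (lengthFn σ) x k + (σ w).length := by
  induction w using FreeMonoid.inductionOn' generalizing k with
  | one => simp
  | of_mul a w ih =>
    rw [occursAt_mul, occursAt_of] at h
    simp only [FreeMonoid.length_mul, map_mul, FreeMonoid.length_of, Nat.cast_add, Nat.cast_one,
      ← add_assoc, length_map_of] at h ⊢
    rw [ih h.2, blockStart_add_one, h.1]

theorem OccursAt.map {w : FreeMonoid A} {x : ℤ → A} {k : ℤ} (h : OccursAt w x k) :
    OccursAt (σ w) (imageWord hσ x) (blockStart (lengthFn σ) x k) := by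
  induction w using FreeMonoid.inductionOn' generalizing k with
  | one => simpa using occursAt_one _ _
  | of_mul a w ih =>
    rw [occursAt_mul, occursAt_of] at h
    rw [map_mul, occursAt_mul]
    obtain ⟨rfl, h⟩ := h
    refine ⟨occursAt_imageWord_of hσ x k, ?_⟩
    rw [length_map_of, ← blockStart_add_one]
    exact ih h

theorem imageWord_shift (x : ℤ → A) (j : ℤ) :
    imageWord hσ (shift j x) = shift (blockStart (lengthFn σ) x j) (imageWord hσ x) := by
  refine (imageWord_unique hσ fun n => ?_).symm
  rw [occursAt_shift, blockStart_shift, add_sub_cancel]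
  exact occursAt_imageWord_of hσ x (j + n)

theorem NonErasing.comp {σ' : FreeMonoid B →* FreeMonoid C} (hσ' : NonErasing σ')
    (hσ : NonErasing σ) : NonErasing (σ'.comp σ) := by
  intro a
  rw [MonoidHom.comp_apply]
  induction h : σ (FreeMonoid.of a) using FreeMonoid.inductionOn' with
  | one => exact absurd h (hσ a)
  | of_mul b w _ =>
    intro h1
    rw [map_mul] at h1
    have := congrArg FreeMonoid.length h1
    rw [FreeMonoid.length_mul, length_map_of, FreeMonoid.length_one] at this
    have := hσ'.lengthFn_pos b
    omega

theorem blockStart_comp (σ' : FreeMonoid B →* FreeMonoid C) (x : ℤ → A) (n : ℤ) :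
    blockStart (lengthFn (σ'.comp σ)) x n =
      blockStart (lengthFn σ') (imageWord hσ x) (blockStart (lengthFn σ) x n) := by
  refine (blockStart_unique _ (g := fun n => blockStart (lengthFn σ') (imageWord hσ x)
    (blockStart (lengthFn σ) x n)) (by simp) (fun n => ?_) n).symm
  rw [blockStart_add_one, ← length_map_of,
    blockStart_add_length σ' (occursAt_imageWord_of hσ x n)]
  rfl

theorem imageWord_comp {σ' : FreeMonoid B →* FreeMonoid C} (hσ' : NonErasing σ') (x : ℤ → A) :
    imageWord (hσ'.comp hσ) x = imageWord hσ' (imageWord hσ x) := by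
  refine (imageWord_unique _ fun n => ?_).symm
  rw [blockStart_comp hσ]
  exact (occursAt_imageWord_of hσ x n).map hσ'

end ImageWord

end MeasureTransfer

namespace MeasureTransfer

/-! ### The topology of bi-infinite words -/

section CentralCylinder

variable {A : Type*}

/-- The words which agree with `y` on the interval `[-N, N]`. -/
def centralCylinder (y : ℤ → A) (N : ℕ) : Set (ℤ → A) :=
  {z | ∀ i : ℤ, -N ≤ i → i ≤ N → z i = y i}

theorem mem_centralCylinder_self (y : ℤ → A) (N : ℕ) : y ∈ centralCylinder y N :=
  fun _ _ _ => rfl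

theorem centralCylinder_anti (y : ℤ → A) {M N : ℕ} (h : M ≤ N) :
    centralCylinder y N ⊆ centralCylinder y M :=
  fun _ hz i h1 h2 => hz i (by omega) (by omega)

theorem centralCylinder_eq_of_mem {y z : ℤ → A} {N : ℕ} (h : z ∈ centralCylinder y N) :
    centralCylinder z N = centralCylinder y N := by
  ext t
  exact forall_congr' fun i => forall_congr' fun h1 => forall_congr' fun h2 => by rw [h i h1 h2]

theorem centralCylinder_eq (y : ℤ → A) (N : ℕ) :
    centralCylinder y N = {z | OccursAt (wordAt y (-N) (2 * N + 1)) z (-N)} := by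
  ext z
  rw [Set.mem_ofPred_eq, occursAt_wordAt_iff]
  constructor
  · intro h i hi
    exact h _ (by omega) (by omega)
  · intro h i h1 h2
    have := h (i + N).toNat (by omega)
    rwa [Int.toNat_of_nonneg (by omega), neg_add_cancel_comm_assoc] at this

variable [TopologicalSpace A]

theorem isOpen_centralCylinder [DiscreteTopology A] (y : ℤ → A) (N : ℕ) : IsOpen (centralCylinder y N) := by
  have : centralCylinder y N = (Set.Icc (-N : ℤ) N).pi fun i => {y i} := by
    ext z
    simp [centralCylinder, Set.mem_pi]
  rw [this]
  exact isOpen_set_pi (Set.finite_Icc _ _) fun _ _ => isOpen_discrete _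

theorem exists_centralCylinder_subset {y : ℤ → A} {U : Set (ℤ → A)} (hU : U ∈ nhds y) :
    ∃ N, centralCylinder y N ⊆ U := by
  rw [nhds_pi, Filter.mem_pi] at hU
  obtain ⟨I, hI, t, ht, hU⟩ := hU
  obtain ⟨N, hN⟩ := (hI.image Int.natAbs).bddAbove
  refine ⟨N, fun z hz => hU fun i hi => ?_⟩
  have := hN (Set.mem_image_of_mem _ hi)
  rw [hz i (by omega) (by omega)]
  exact mem_of_mem_nhds (ht i)

variable [DiscreteTopology A]

theorem isTopologicalBasis_centralCylinder :
    TopologicalSpace.IsTopologicalBasis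
      {U : Set (ℤ → A) | ∃ y N, centralCylinder y N = U} := by
  refine TopologicalSpace.isTopologicalBasis_of_isOpen_of_nhds ?_ fun y U hy hU => ?_
  · rintro _ ⟨y, N, rfl⟩
    exact isOpen_centralCylinder y N
  · obtain ⟨N, hN⟩ := exists_centralCylinder_subset (hU.mem_nhds hy)
    exact ⟨_, ⟨y, N, rfl⟩, mem_centralCylinder_self y N, hN⟩

theorem isClopen_occursAt (w : FreeMonoid A) (k : ℤ) : IsClopen {x : ℤ → A | OccursAt w x k} := by
  have : {x : ℤ → A | OccursAt w x k} = ⋂ i : Fin (FreeMonoid.toList w).length,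
      (fun x : ℤ → A => x (k + (i : ℕ))) ⁻¹' {(FreeMonoid.toList w)[i]} := by
    ext x
    simp only [OccursAt, Set.mem_ofPred_eq, Set.mem_iInter, Set.mem_preimage,
      Set.mem_singleton_iff, Fin.forall_iff]
    rfl
  rw [this]
  exact isClopen_iInter_of_finite fun i => (isClopen_discrete _).preimage (continuous_apply _)

end CentralCylinder

/-! ### Continuity of block positions and image words -/

section Continuity

variable {A B : Type*} [TopologicalSpace A] [DiscreteTopology A]

theorem continuous_blockStart (ℓ : A → ℕ) (n : ℤ) :
    Continuous fun x : ℤ → A => blockStart ℓ x n := by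
  have h : ∀ i : ℤ, Continuous fun x : ℤ → A => (ℓ (x i) : ℤ) := fun i =>
    (continuous_of_discreteTopology (f := fun a => (ℓ a : ℤ))).comp (continuous_apply i)
  exact (continuous_finsetSum _ fun i _ => h i).sub (continuous_finsetSum _ fun i _ => h i)

variable [TopologicalSpace B] [DiscreteTopology B] {σ : FreeMonoid A →* FreeMonoid B}

/-- The letter at p depends only on the letter and the starting position of the block of x
containing p, and both are locally constant in x. -/
theorem continuous_imageWord (hσ : NonErasing σ) : Continuous (imageWord hσ) := by
  refine continuous_pi fun p => continuous_iff_continuousAt.2 fun x => ?_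
  obtain ⟨n, hn, hn'⟩ := exists_block hσ.lengthFn_pos x p
  rw [blockStart_add_one] at hn'
  have h1 : ∀ᶠ z in nhds x, z n = x n :=
    (continuous_apply n).continuousAt.preimage_mem_nhds ((isOpen_discrete {x n}).mem_nhds rfl)
  have h2 : ∀ᶠ z in nhds x, blockStart (lengthFn σ) z n = blockStart (lengthFn σ) x n :=
    (continuous_blockStart (lengthFn σ) n).continuousAt.preimage_mem_nhds
      ((isOpen_discrete {blockStart (lengthFn σ) x n}).mem_nhds rfl)
  rw [ContinuousAt, nhds_discrete B, Filter.tendsto_pure]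
  filter_upwards [h1, h2] with z hz1 hz2
  have hz := occursAt_imageWord_of hσ z n
  rw [hz1, hz2] at hz
  have := hz.apply_eq (occursAt_imageWord_of hσ x n)
    (i := (p - blockStart (lengthFn σ) x n).toNat) (by rw [length_map_of]; omega)
  rwa [Int.toNat_of_nonneg (by omega), add_sub_cancel] at this

end Continuity

/-! ### The image subshift -/

section ImageSubshift

variable {A B C : Type*}

theorem shift_mem_of_image_shift {X : Set (ℤ → A)} (hX : shift (1 : ℤ) '' X = X) {x : ℤ → A}
    (hx : x ∈ X) (j : ℤ) : shift j x ∈ X := by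
  induction j using Int.induction_on with
  | zero => simpa using hx
  | succ n ih =>
    rw [shift_add, ← hX]
    exact Set.mem_image_of_mem _ ih
  | pred n ih =>
    rw [← hX] at ih
    obtain ⟨y, hy, h⟩ := ih
    convert hy
    funext k
    have := congrFun h (-1 + k)
    simp only [shift_apply, ← add_assoc, add_neg_cancel, zero_add] at this ⊢
    rw [this]
    congr 1

variable {σ : FreeMonoid A →* FreeMonoid B} (hσ : NonErasing σ)

/-- The set of all shifts of the images of the elements of `X`. -/
def orbitImage (X : Set (ℤ → A)) : Set (ℤ → B) :=
  {y | ∃ m : ℤ, ∃ x ∈ X, shift m (imageWord hσ x) = y}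

theorem shift_mem_orbitImage {X : Set (ℤ → A)} {y : ℤ → B} (hy : y ∈ orbitImage hσ X) (j : ℤ) :
    shift j y ∈ orbitImage hσ X := by
  obtain ⟨m, x, hx, rfl⟩ := hy
  exact ⟨m + j, x, hx, shift_add _ _ _⟩

theorem image_shift_orbitImage (X : Set (ℤ → A)) :
    shift (1 : ℤ) '' orbitImage hσ X = orbitImage hσ X := by
  refine Set.Subset.antisymm ?_ fun y hy => ⟨shift (-1) y, shift_mem_orbitImage hσ hy _, ?_⟩
  · rintro _ ⟨y, hy, rfl⟩
    exact shift_mem_orbitImage hσ hy 1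
  · rw [← shift_add, neg_add_cancel, shift_zero]

/-- A shift of the image of `x` is a shift of the image of some shift `z` of `x`, by less than the
length of the image of `z 0`. -/
theorem exists_shift_imageWord_eq (x : ℤ → A) (m : ℤ) :
    ∃ (j : ℤ) (k : ℕ), k < lengthFn σ (shift j x 0) ∧
      shift m (imageWord hσ x) = shift (k : ℤ) (imageWord hσ (shift j x)) := by
  obtain ⟨j, hj, hj'⟩ := exists_block hσ.lengthFn_pos x m
  rw [blockStart_add_one] at hj'
  refine ⟨j, (m - blockStart (lengthFn σ) x j).toNat, ?_, ?_⟩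
  · rw [shift_apply, add_zero]
    omega
  · rw [Int.toNat_of_nonneg (by omega), imageWord_shift, ← shift_add, add_sub_cancel]

theorem orbitImage_comp {σ' : FreeMonoid B →* FreeMonoid C} (hσ' : NonErasing σ')
    (X : Set (ℤ → A)) :
    orbitImage (hσ'.comp hσ) X = orbitImage hσ' (orbitImage hσ X) := by
  ext y
  constructor
  · rintro ⟨m, x, hx, rfl⟩
    exact ⟨m, imageWord hσ x, ⟨0, x, hx, shift_zero _⟩, by rw [imageWord_comp hσ hσ']⟩
  · rintro ⟨m, _, ⟨j, x, hx, rfl⟩, rfl⟩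
    exact ⟨_, x, hx, by rw [imageWord_comp hσ hσ', imageWord_shift, ← shift_add]⟩

theorem exists_lengthFn_le [Finite A] (σ : FreeMonoid A →* FreeMonoid B) : ∃ N, ∀ a, lengthFn σ a ≤ N :=
  (Set.finite_range (lengthFn σ)).bddAbove.imp fun _ hN a => hN ⟨a, rfl⟩

variable [TopologicalSpace A] [DiscreteTopology A] [Finite A]
  [TopologicalSpace B] [DiscreteTopology B]

/-- Shifting x inside X absorbs whole blocks, so only finitely many offsets remain and the set is a
finite union of continuous images of a compact set. -/
theorem isCompact_orbitImage {X : Set (ℤ → A)} (hX : IsClosed X)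
    (hXT : shift (1 : ℤ) '' X = X) : IsCompact (orbitImage hσ X) := by
  obtain ⟨N, hN⟩ := exists_lengthFn_le σ
  have : orbitImage hσ X =
      ⋃ k ∈ Finset.range N, (fun x => shift (k : ℤ) (imageWord hσ x)) '' X := by
    ext y
    simp only [Set.mem_iUnion, Finset.mem_range]
    constructor
    · rintro ⟨m, x, hx, rfl⟩
      obtain ⟨j, k, hk, h⟩ := exists_shift_imageWord_eq hσ x m
      exact ⟨k, hk.trans_le (hN _), shift j x, shift_mem_of_image_shift hXT hx j, h.symm⟩
    · rintro ⟨k, -, x, hx, rfl⟩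
      exact ⟨k, x, hx, rfl⟩
  rw [this]
  exact (Finset.range N).isCompact_biUnion fun k _ =>
    hX.isCompact.image ((continuous_shift _).comp (continuous_imageWord hσ))

/-- A point of the image subshift agrees on each central window with a shifted image of a point of
X, so it lies in the closure of the orbit image, which is already closed. -/
theorem imageSubshift_eq_orbitImage {X : Set (ℤ → A)} (hX : IsClosed X)
    (hXT : shift (1 : ℤ) '' X = X) : imageSubshift σ X = orbitImage hσ X := by
  apply Set.Subset.antisymm
  · intro y hy
    rw [← (isCompact_orbitImage hσ hX hXT).isClosed.closure_eq, mem_closure_iff_nhds]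
    intro U hU
    obtain ⟨N, hN⟩ := exists_centralCylinder_subset hU
    obtain ⟨_, ⟨w, ⟨x, hx, k, hw⟩, rfl⟩, hf⟩ := hy _ _ (occursAt_wordAt y (-N) (2 * N + 1))
    obtain ⟨i, -, hi⟩ := (hw.map hσ).exists_of_isFactor hf
    refine ⟨shift (blockStart (lengthFn σ) x k + i + N) (imageWord hσ x), hN ?_, _, x, hx, rfl⟩
    rw [centralCylinder_eq, Set.mem_ofPred_eq, occursAt_shift]
    convert hi using 1
    ring
  · rintro _ ⟨m, x, hx, rfl⟩ u k hu
    rw [occursAt_shift] at hu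
    obtain ⟨n, hn, hn'⟩ := exists_block hσ.lengthFn_pos x (m + k)
    -- One block for the starting position of u, and |u| more of length at least one, are enough to
    -- cover u.
    have hw := occursAt_wordAt x n (u.length + 1)
    refine ⟨_, ⟨_, ⟨x, hx, n, hw⟩, rfl⟩, (hw.map hσ).isFactor
      (i := (m + k - blockStart (lengthFn σ) x n).toNat) ?_ ?_⟩
    · rwa [Int.toNat_of_nonneg (by omega), add_sub_cancel]
    · have h1 := blockStart_add_length σ hw
      have h2 := sub_le_blockStart_sub hσ.lengthFn_pos x (m := n + 1) (n := n + (u.length + 1))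
        (by omega)
      rw [length_wordAt] at h1
      push_cast at h1
      omega

theorem isSubshift_imageSubshift {X : Set (ℤ → A)} (hX : IsSubshift X) (hσ : NonErasing σ) :
    IsSubshift (imageSubshift σ X) := by
  rw [imageSubshift_eq_orbitImage hσ hX.isClosed hX.image_shift]
  obtain ⟨x, hx⟩ := hX.nonempty
  exact ⟨⟨_, 0, x, hx, rfl⟩, (isCompact_orbitImage hσ hX.isClosed hX.image_shift).isClosed,
    image_shift_orbitImage hσ X⟩

end ImageSubshift

/-! ### Invariant measures on bi-infinite words -/

section Invariant

variable {A : Type*} [TopologicalSpace A] [DiscreteTopology A]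
  [MeasurableSpace A] [DiscreteMeasurableSpace A]

theorem measurableSet_occursAt [Finite A] (w : FreeMonoid A) (k : ℤ) :
    MeasurableSet {x : ℤ → A | OccursAt w x k} :=
  (isClopen_occursAt w k).isOpen.measurableSet

theorem measure_occursAt_eq [Finite A] {μ : Measure (ℤ → A)}
    (hμ : MeasurePreserving (shift (1 : ℤ)) μ μ) (w : FreeMonoid A) (k : ℤ) :
    μ {x | OccursAt w x k} = μ (cylinder w) := by
  have h : ∀ k : ℤ, μ {x | OccursAt w x (1 + k)} = μ {x | OccursAt w x k} := fun k => by
    rw [← hμ.measure_preimage (measurableSet_occursAt w k).nullMeasurableSet]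
    congr 1
    ext x
    exact occursAt_shift.symm
  have h0 : ∀ k : ℤ, μ {x | OccursAt w x k} = μ {x | OccursAt w x 0} := fun k => by
    induction k using Int.induction_on with
    | zero => rfl
    | succ n ih => rw [add_comm, h, ih]
    | pred n ih => rw [← ih, ← h (-n - 1), add_sub_cancel]
  exact (h0 k).trans (h0 1).symm

theorem eq_of_cylinder_eq [Finite A] {μ ν : Measure (ℤ → A)} [IsFiniteMeasure μ]
    (hμ : MeasurePreserving (shift (1 : ℤ)) μ μ) (hν : MeasurePreserving (shift (1 : ℤ)) ν ν)
    (h : ∀ w : FreeMonoid A, w ≠ 1 → μ (cylinder w) = ν (cylinder w)) : μ = ν := by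
  refine ext_of_generate_finite
    {U : Set (ℤ → A) | ∃ y N, centralCylinder y N = U} ?_ ?_ ?_ ?_
  · rw [← isTopologicalBasis_centralCylinder.borel_eq_generateFrom]
    exact BorelSpace.measurable_eq
  -- Recentring both cylinders at a common point t makes them nested, which gives a π-system.
  · rintro _ ⟨y, M, rfl⟩ _ ⟨z, N, rfl⟩ ⟨t, ht1, ht2⟩
    refine ⟨t, max M N, ?_⟩
    rw [← centralCylinder_eq_of_mem ht1, ← centralCylinder_eq_of_mem ht2]
    rcases le_total M N with hMN | hMN
    · rw [max_eq_right hMN, Set.inter_eq_right.2 (centralCylinder_anti t hMN)]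
    · rw [max_eq_left hMN, Set.inter_eq_left.2 (centralCylinder_anti t hMN)]
  · rintro _ ⟨y, N, rfl⟩
    rw [centralCylinder_eq, measure_occursAt_eq hμ, measure_occursAt_eq hν]
    refine h _ fun h1 => ?_
    have := congrArg FreeMonoid.length h1
    simp at this
  -- The empty word is excluded from the hypothesis, so the total mass is recovered from the words
  -- of length one.
  · have := Fintype.ofFinite A
    have hsum : ∀ ρ : Measure (ℤ → A),
        ρ Set.univ = ∑ a : A, ρ (cylinder (FreeMonoid.of a)) := fun ρ => by
      rw [← Set.preimage_univ (f := fun x : ℤ → A => x 1), ← Finset.coe_univ,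
        ← sum_measure_preimage_singleton]
      · refine Finset.sum_congr rfl fun a _ => ?_
        congr 1
        ext x
        exact occursAt_of.symm
      · exact fun a _ => measurable_pi_apply 1 (MeasurableSet.of_discrete)
    rw [hsum, hsum]
    exact Finset.sum_congr rfl fun a _ => h _ (FreeMonoid.of_ne_one a)

theorem image_shift_support {μ : Measure (ℤ → A)} [Finite A]
    (hμ : MeasurePreserving (shift (1 : ℤ)) μ μ) :
    shift (1 : ℤ) '' μ.support = μ.support := by
  have key : ∀ x : ℤ → A, shift 1 x ∈ μ.support ↔ x ∈ μ.support := fun x => by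
    rw [Measure.mem_support_iff_forall, Measure.mem_support_iff_forall]
    constructor
    · intro h U hU
      have hV : shift (-1 : ℤ) ⁻¹' interior U ∈ nhds (shift (1 : ℤ) x) := by
        refine (isOpen_interior.preimage (continuous_shift _)).mem_nhds ?_
        rw [Set.mem_preimage, ← shift_add, add_neg_cancel, shift_zero]
        exact mem_interior_iff_mem_nhds.2 hU
      have := h _ hV
      rw [← hμ.measure_preimage
        (isOpen_interior.preimage (continuous_shift _)).measurableSet.nullMeasurableSet,
        ← Set.preimage_comp] at this
      refine this.trans_le (measure_mono fun z hz => interior_subset (s := U) ?_)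
      rwa [Set.mem_preimage, Function.comp_apply, ← shift_add, add_neg_cancel, shift_zero] at hz
    · intro h U hU
      have := h _ ((continuous_shift (1 : ℤ)).continuousAt.preimage_mem_nhds
        (interior_mem_nhds.2 hU))
      rw [hμ.measure_preimage isOpen_interior.measurableSet.nullMeasurableSet] at this
      exact this.trans_le (measure_mono interior_subset)
  refine Set.Subset.antisymm ?_ fun x hx => ⟨shift (-1) x, ?_, ?_⟩
  · rintro _ ⟨x, hx, rfl⟩
    exact (key x).2 hx
  · rw [← key, ← shift_add, neg_add_cancel, shift_zero]
    exact hx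
  · rw [← shift_add, neg_add_cancel, shift_zero]

end Invariant

end MeasureTransfer

namespace MeasureTransfer

/-! ### Sums over blocks -/

section BlockSum

variable {A B C M : Type*} [AddCommMonoid M] {σ : FreeMonoid A →* FreeMonoid B}
  (hσ : NonErasing σ)

/-- The sum of `f` over the shifts of the image of `x` by all positions in the block of `x 0`. -/
noncomputable def blockSum (f : (ℤ → B) → M) (x : ℤ → A) : M :=
  ∑ k ∈ Finset.range (lengthFn σ (x 0)), f (shift (k : ℤ) (imageWord hσ x))

theorem sum_range_blockStart (f : (ℤ → B) → M) (x : ℤ → A) (n L : ℕ)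
    (h : blockStart (lengthFn σ) x n = L) :
    ∑ k ∈ Finset.range L, f (shift (k : ℤ) (imageWord hσ x)) =
      ∑ i ∈ Finset.range n, blockSum hσ f (shift (i : ℤ) x) := by
  induction n generalizing L with
  | zero =>
    have : L = 0 := by simpa using h.symm
    simp [this]
  | succ n ih =>
    have hn := sub_le_blockStart_sub hσ.lengthFn_pos x (Int.natCast_nonneg n)
    rw [blockStart_zero] at hn
    obtain ⟨L', hL'⟩ : ∃ L' : ℕ, blockStart (lengthFn σ) x n = L' :=
      Int.eq_ofNat_of_zero_le (by omega)
    have hL : L = L' + lengthFn σ (x n) := by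
      push_cast at h
      rw [blockStart_add_one, hL'] at h
      omega
    rw [hL, Finset.sum_range_add, ih L' hL', Finset.sum_range_succ, blockSum, shift_apply,
      add_zero]
    congr 1
    refine Finset.sum_congr rfl fun k _ => ?_
    rw [imageWord_shift, hL', ← shift_add, Nat.cast_add]

/-- The σ'∘σ-block of x₀ is the concatenation of the σ'-blocks of the letters of σ(x₀). This is
functoriality at the level of functions. -/
theorem blockSum_comp {σ' : FreeMonoid B →* FreeMonoid C} (hσ' : NonErasing σ')
    (f : (ℤ → C) → M) (x : ℤ → A) :
    blockSum (hσ'.comp hσ) f x = blockSum hσ (blockSum hσ' f) x := by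
  unfold blockSum
  rw [imageWord_comp hσ hσ', sum_range_blockStart hσ' f (imageWord hσ x) (lengthFn σ (x 0))]
  · rfl
  · rw [← blockStart_one, ← blockStart_comp, blockStart_one]

/-- Both sides are the sum over 0 ≤ k ≤ |σ(x₀)|, with the first or the last term split off. The
additive form avoids subtraction, since M may be `ENNReal`. -/
theorem blockSum_comp_shift_add (f : (ℤ → B) → M) (x : ℤ → A) :
    blockSum hσ (fun y => f (shift (1 : ℤ) y)) x + f (imageWord hσ x) =
      blockSum hσ f x + f (imageWord hσ (shift (1 : ℤ) x)) := by
  unfold blockSum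
  rw [imageWord_shift, blockStart_one,
    ← Finset.sum_range_succ (fun k : ℕ => f (shift (k : ℤ) (imageWord hσ x))),
    Finset.sum_range_succ']
  simp [shift_add]

theorem continuous_shift_imageWord [TopologicalSpace A] [DiscreteTopology A] [TopologicalSpace B]
    [DiscreteTopology B] (k : ℤ) : Continuous fun x => shift k (imageWord hσ x) :=
  (continuous_shift k).comp (continuous_imageWord hσ)

theorem continuous_blockSum [TopologicalSpace A] [DiscreteTopology A] [TopologicalSpace B]
    [DiscreteTopology B] [TopologicalSpace M] [ContinuousAdd M] {f : (ℤ → B) → M}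
    (hf : Continuous f) : Continuous (blockSum hσ f) := by
  -- Making the letter x₀ a separate discrete variable fixes the range of summation.
  have h : Continuous fun p : A × (ℤ → A) =>
      ∑ k ∈ Finset.range (lengthFn σ p.1), f (shift (k : ℤ) (imageWord hσ p.2)) := by
    refine continuous_prod_of_discrete_left.2 fun a => ?_
    have hk : ∀ k : ℕ, Continuous fun x => f (shift (k : ℤ) (imageWord hσ x)) := fun k =>
      hf.comp (continuous_shift_imageWord hσ k)
    exact continuous_finsetSum (Finset.range (lengthFn σ a)) fun k _ => hk k
  have h' : Continuous fun x : ℤ → A => (x 0, x) := (continuous_apply 0).prodMk continuous_id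
  exact h.comp h'

end BlockSum

/-! ### The transferred measure as an average over blocks -/

section TransferMeasure

theorem isOpen_lt_lengthFn {A B : Type*} [TopologicalSpace A] [DiscreteTopology A]
    (σ : FreeMonoid A →* FreeMonoid B) (k : ℕ) :
    IsOpen {x : ℤ → A | k < lengthFn σ (x 0)} :=
  (isOpen_discrete {a | k < lengthFn σ a}).preimage
    (continuous_apply 0 : Continuous fun x : ℤ → A => x 0)

theorem imageSubshift_mono {A B : Type*} (σ : FreeMonoid A →* FreeMonoid B) {X X' : Set (ℤ → A)}
    (h : X ⊆ X') : imageSubshift σ X ⊆ imageSubshift σ X' := by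
  intro y hy u k hu
  obtain ⟨_, ⟨w, ⟨x, hx, l, hw⟩, rfl⟩, hf⟩ := hy u k hu
  exact ⟨_, ⟨w, ⟨x, h hx, l, hw⟩, rfl⟩, hf⟩

variable {A B C : Type*} [Finite A] [TopologicalSpace A] [DiscreteTopology A]
  [MeasurableSpace A] [DiscreteMeasurableSpace A]
  [Finite B] [TopologicalSpace B] [DiscreteTopology B]
  [MeasurableSpace B] [DiscreteMeasurableSpace B]
  [Finite C] [TopologicalSpace C] [DiscreteTopology C]
  [MeasurableSpace C] [DiscreteMeasurableSpace C]
  {σ : FreeMonoid A →* FreeMonoid B} (hσ : NonErasing σ)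

theorem measurable_shift (k : ℤ) : Measurable (shift k : (ℤ → A) → ℤ → A) :=
  (continuous_shift k).measurable

theorem measurable_shift_imageWord (k : ℤ) :
    Measurable fun x => shift k (imageWord hσ x) :=
  (continuous_shift_imageWord hσ k).measurable

theorem measurable_blockSum {f : (ℤ → B) → ENNReal} (hf : Measurable f) :
    Measurable (blockSum hσ f) := by
  have h : Measurable fun p : A × (ℤ → A) =>
      ∑ k ∈ Finset.range (lengthFn σ p.1), f (shift (k : ℤ) (imageWord hσ p.2)) := by
    refine measurable_from_prod_countable_right fun a => ?_
    have hk : ∀ k : ℕ, Measurable fun x => f (shift (k : ℤ) (imageWord hσ x)) := fun k =>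
      hf.comp (measurable_shift_imageWord hσ k)
    exact Finset.measurable_fun_sum (Finset.range (lengthFn σ a)) fun k _ => hk k
  have h' : Measurable fun x : ℤ → A => (x 0, x) := (measurable_pi_apply 0).prodMk measurable_id
  exact h.comp h'

/-- The sum over all `k` of the push-forwards, under the shift by `k` of the image word, of the
restriction of `μ` to the set of all `x` for which the image of `x 0` has length exceeding `k`. -/
noncomputable def transferMeasure (μ : Measure (ℤ → A)) : Measure (ℤ → B) :=
  Measure.sum fun k : ℕ =>
    (μ.restrict {x | k < lengthFn σ (x 0)}).map fun x => shift (k : ℤ) (imageWord hσ x)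

theorem lintegral_transferMeasure (μ : Measure (ℤ → A)) {f : (ℤ → B) → ENNReal}
    (hf : Measurable f) : ∫⁻ y, f y ∂transferMeasure hσ μ = ∫⁻ x, blockSum hσ f x ∂μ := by
  rw [transferMeasure, lintegral_sum_measure]
  have h : ∀ k : ℕ, ∫⁻ y, f y ∂(μ.restrict {x | k < lengthFn σ (x 0)}).map
      (fun x => shift (k : ℤ) (imageWord hσ x)) = ∫⁻ x, {x | k < lengthFn σ (x 0)}.indicator
        (fun x => f (shift (k : ℤ) (imageWord hσ x))) x ∂μ := fun k => by
    rw [lintegral_map hf (measurable_shift_imageWord hσ k),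
      lintegral_indicator (isOpen_lt_lengthFn σ k).measurableSet]
  simp_rw [h]
  have hm : ∀ k : ℕ, Measurable ({x | k < lengthFn σ (x 0)}.indicator
      (fun x => f (shift (k : ℤ) (imageWord hσ x)))) := fun k =>
    (hf.comp (measurable_shift_imageWord hσ k)).indicator (isOpen_lt_lengthFn σ k).measurableSet
  rw [← lintegral_tsum fun k => (hm k).aemeasurable]
  refine lintegral_congr fun x => ?_
  rw [tsum_eq_sum (s := Finset.range (lengthFn σ (x 0))), blockSum]
  · refine Finset.sum_congr rfl fun k hk => ?_
    exact Set.indicator_of_mem (s := {x : ℤ → A | k < lengthFn σ (x 0)}) (Finset.mem_range.1 hk) _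
  · intro k hk
    exact Set.indicator_of_notMem (by simpa using hk) _

theorem transferMeasure_apply (μ : Measure (ℤ → A)) {s : Set (ℤ → B)} (hs : MeasurableSet s) :
    transferMeasure hσ μ s = ∫⁻ x, blockSum hσ (s.indicator 1) x ∂μ := by
  rw [← lintegral_transferMeasure hσ μ (measurable_one.indicator hs), lintegral_indicator_one hs]

instance isFiniteMeasure_transferMeasure (μ : Measure (ℤ → A)) [IsFiniteMeasure μ] :
    IsFiniteMeasure (transferMeasure hσ μ) where
  measure_univ_lt_top := by
    obtain ⟨N, hN⟩ := exists_lengthFn_le σ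
    rw [transferMeasure_apply hσ μ MeasurableSet.univ]
    refine (lintegral_mono (g := fun _ => (N : ENNReal)) fun x => ?_).trans_lt ?_
    · simpa [blockSum] using hN (x 0)
    · rw [lintegral_const]
      exact ENNReal.mul_lt_top (by simp) (measure_lt_top _ _)

theorem transferMeasure_add (μ ν : Measure (ℤ → A)) :
    transferMeasure hσ (μ + ν) = transferMeasure hσ μ + transferMeasure hσ ν := by
  ext s hs
  rw [Measure.add_apply, transferMeasure_apply hσ _ hs, transferMeasure_apply hσ _ hs,
    transferMeasure_apply hσ _ hs, lintegral_add_measure]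

theorem transferMeasure_smul (c : ℝ≥0) (μ : Measure (ℤ → A)) :
    transferMeasure hσ (c • μ) = c • transferMeasure hσ μ := by
  ext s hs
  rw [Measure.smul_apply, transferMeasure_apply hσ _ hs, transferMeasure_apply hσ _ hs,
    lintegral_smul_measure]

theorem transferMeasure_comp {σ' : FreeMonoid B →* FreeMonoid C} (hσ' : NonErasing σ')
    (μ : Measure (ℤ → A)) :
    transferMeasure (hσ'.comp hσ) μ = transferMeasure hσ' (transferMeasure hσ μ) := by
  ext s hs
  rw [transferMeasure_apply _ _ hs, transferMeasure_apply _ _ hs,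
    lintegral_transferMeasure _ _ (measurable_blockSum hσ' (measurable_one.indicator hs))]
  exact lintegral_congr fun x => blockSum_comp hσ hσ' _ x

theorem measurePreserving_transferMeasure {μ : Measure (ℤ → A)} [IsFiniteMeasure μ]
    (hμ : MeasurePreserving (shift (1 : ℤ)) μ μ) :
    MeasurePreserving (shift (1 : ℤ)) (transferMeasure hσ μ) (transferMeasure hσ μ) := by
  refine ⟨measurable_shift 1, Measure.ext fun s hs => ?_⟩
  have hf : Measurable (s.indicator (1 : (ℤ → B) → ENNReal)) := measurable_one.indicator hs
  have hfS : Measurable fun x => s.indicator (1 : (ℤ → B) → ENNReal) (imageWord hσ x) :=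
    hf.comp (continuous_imageWord hσ).measurable
  rw [Measure.map_apply (measurable_shift 1) hs, transferMeasure_apply hσ μ hs,
    transferMeasure_apply hσ μ (measurable_shift 1 hs)]
  have h := lintegral_congr (μ := μ) (blockSum_comp_shift_add hσ (s.indicator 1))
  have hfST : Measurable fun x =>
      s.indicator (1 : (ℤ → B) → ENNReal) (imageWord hσ (shift (1 : ℤ) x)) :=
    hfS.comp (measurable_shift 1)
  rw [lintegral_add_right _ hfS, lintegral_add_right _ hfST, hμ.lintegral_comp hfS] at h
  refine (ENNReal.add_left_inj ?_).1 h
  -- Cancellation in `ENNReal` requires the common term to be finite; it is at most the mass of μ.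
  refine ((lintegral_mono (g := fun _ => 1) fun x => ?_).trans_lt ?_).ne
  · exact Set.indicator_le_self' (f := (1 : (ℤ → B) → ENNReal)) (fun _ _ => zero_le) _
  · simp

/-- The mass of U is a sum over k of the μ-masses of open sets, and an open set has positive mass
exactly when it meets the support. -/
theorem transferMeasure_pos_iff (μ : Measure (ℤ → A)) {U : Set (ℤ → B)} (hU : IsOpen U) :
    0 < transferMeasure hσ μ U ↔
      ∃ x ∈ μ.support, ∃ k < lengthFn σ (x 0), shift (k : ℤ) (imageWord hσ x) ∈ U := by
  have hopen : ∀ k : ℕ, IsOpen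
      ((fun x => shift (k : ℤ) (imageWord hσ x)) ⁻¹' U ∩ {x | k < lengthFn σ (x 0)}) := fun k =>
    (hU.preimage (continuous_shift_imageWord hσ k)).inter
      (isOpen_lt_lengthFn σ k)
  have hsum : transferMeasure hσ μ U = ∑' k : ℕ,
      μ ((fun x => shift (k : ℤ) (imageWord hσ x)) ⁻¹' U ∩ {x | k < lengthFn σ (x 0)}) := by
    rw [transferMeasure, Measure.sum_apply _ hU.measurableSet]
    refine tsum_congr fun k => ?_
    rw [Measure.map_apply (measurable_shift_imageWord hσ k) hU.measurableSet,
      Measure.restrict_apply (measurable_shift_imageWord hσ k hU.measurableSet)]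
  rw [hsum, pos_iff_ne_zero, Ne, ENNReal.tsum_eq_zero, not_forall]
  constructor
  · rintro ⟨k, hk⟩
    obtain ⟨x, ⟨hxU, hxk⟩, hx⟩ := Measure.nonempty_inter_support_of_pos (pos_iff_ne_zero.2 hk)
    exact ⟨x, hx, k, hxk, hxU⟩
  · rintro ⟨x, hx, k, hxk, hxU⟩
    exact ⟨k, ((Measure.mem_support_iff_forall x).1 hx _ ((hopen k).mem_nhds ⟨hxU, hxk⟩)).ne'⟩

theorem support_transferMeasure {μ : Measure (ℤ → A)}
    (hμ : MeasurePreserving (shift (1 : ℤ)) μ μ) :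
    (transferMeasure hσ μ).support = orbitImage hσ μ.support := by
  have hT := image_shift_support hμ
  apply Set.Subset.antisymm
  · intro y hy
    rw [← (isCompact_orbitImage hσ Measure.isClosed_support hT).isClosed.closure_eq, mem_closure_iff]
    intro U hU hyU
    have := (Measure.mem_support_iff_forall y).1 hy U (hU.mem_nhds hyU)
    obtain ⟨x, hx, k, -, hxU⟩ := (transferMeasure_pos_iff hσ μ hU).1 this
    exact ⟨_, hxU, k, x, hx, rfl⟩
  · rintro _ ⟨m, x, hx, rfl⟩
    rw [Measure.mem_support_iff_forall]
    intro U hU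
    refine lt_of_lt_of_le ?_ (measure_mono (interior_subset (s := U)))
    rw [transferMeasure_pos_iff hσ μ isOpen_interior]
    obtain ⟨j, k, hk, h⟩ := exists_shift_imageWord_eq hσ x m
    refine ⟨shift j x, shift_mem_of_image_shift hT hx j, k, hk, ?_⟩
    rw [← h]
    exact mem_interior_iff_mem_nhds.2 hU

theorem support_transferMeasure_eq_imageSubshift {μ : Measure (ℤ → A)}
    (hμ : MeasurePreserving (shift (1 : ℤ)) μ μ) :
    (transferMeasure hσ μ).support = imageSubshift σ μ.support := by
  rw [support_transferMeasure hσ hμ,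
    imageSubshift_eq_orbitImage hσ Measure.isClosed_support (image_shift_support hμ)]

/-- The transferred measure of a finite measure. -/
noncomputable def transfer (μ : FiniteMeasure (ℤ → A)) : FiniteMeasure (ℤ → B) :=
  ⟨transferMeasure hσ μ, inferInstance⟩

theorem toMeasure_transfer (μ : FiniteMeasure (ℤ → A)) :
    (transfer hσ μ : Measure (ℤ → B)) = transferMeasure hσ μ := rfl

theorem transfer_mem_invariantMeasures {X : Set (ℤ → A)} {μ : FiniteMeasure (ℤ → A)}
    (hμ : μ ∈ invariantMeasures X) : transfer hσ μ ∈ invariantMeasures (imageSubshift σ X) := by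
  refine ⟨measurePreserving_transferMeasure hσ hμ.1, ?_⟩
  rw [toMeasure_transfer, support_transferMeasure_eq_imageSubshift hσ hμ.1]
  exact imageSubshift_mono σ hμ.2

theorem continuous_transfer : Continuous (transfer hσ) := by
  rw [FiniteMeasure.continuous_iff_forall_continuousMap_continuous_lintegral]
  intro f
  have hf : ∀ x, blockSum hσ (fun y => (f y : ENNReal)) x =
      ((⟨blockSum hσ f, continuous_blockSum hσ f.continuous⟩ : C(ℤ → A, ℝ≥0)) x : ENNReal) :=
    fun x => by simp [blockSum]
  simp_rw [toMeasure_transfer,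
    lintegral_transferMeasure hσ _ (f.continuous.measurable.coe_nnreal_ennreal), hf]
  exact FiniteMeasure.continuous_lintegral_continuousMap _

end TransferMeasure

end MeasureTransfer

namespace MeasureTransfer

/-! ### Reading words in subdivided bi-infinite words -/

section Subdivision

variable {A : Type*} {ℓ : A → ℕ}

theorem toList_subdivision_of (ℓ : A → ℕ) (a : A) :
    FreeMonoid.toList (subdivision ℓ (FreeMonoid.of a)) =
      List.ofFn fun k : Fin (ℓ a) => (⟨a, k⟩ : SubdivisionAlphabet ℓ) := by
  simp [subdivision]

theorem lengthFn_subdivision (ℓ : A → ℕ) : lengthFn (subdivision ℓ) = ℓ := by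
  funext a
  simp [lengthFn, toList_subdivision_of]

theorem nonErasing_subdivision (hℓ : ∀ a, 0 < ℓ a) : NonErasing (subdivision ℓ) := by
  intro a h
  have := congrFun (lengthFn_subdivision ℓ) a
  rw [← length_map_of, h, FreeMonoid.length_one] at this
  exact (hℓ a).ne this

variable (hπ : NonErasing (subdivision ℓ))

theorem imageWord_subdivision_apply (x : ℤ → A) (n : ℤ) {k : ℕ} (hk : k < ℓ (x n)) :
    imageWord hπ x (blockStart ℓ x n + k) = ⟨x n, ⟨k, hk⟩⟩ := by
  have h := occursAt_imageWord_of hπ x n k (by simpa [toList_subdivision_of] using hk)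
  rw [lengthFn_subdivision] at h
  rw [h]
  simp [toList_subdivision_of]

theorem NonErasing.pos_of_subdivision {ℓ : A → ℕ} (hπ : NonErasing (subdivision ℓ)) (a : A) :
    0 < ℓ a := by
  have := hπ.lengthFn_pos a
  rwa [lengthFn_subdivision] at this

/-- A non-empty word which is read in the subdivisions of `x` and `y`, starting in the blocks of
`x 0` and `y 0`, determines the starting position and all letters whose blocks it meets. -/
theorem eq_of_occursAt_subdivision {u : FreeMonoid (SubdivisionAlphabet ℓ)} (hu : u ≠ 1)
    {x y : ℤ → A} {k l : ℕ} (hk : k < ℓ (x 0)) (hl : l < ℓ (y 0))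
    (hx : OccursAt u (imageWord hπ x) k) (hy : OccursAt u (imageWord hπ y) l) :
    k = l ∧ ∀ n : ℕ, blockStart ℓ x n < k + u.length → x n = y n := by
  have hu0 : 0 < u.length := Nat.pos_of_ne_zero (by simpa using hu)
  -- The first letter of u records both the original letter and the offset in its block.
  have h0 : (⟨x 0, ⟨k, hk⟩⟩ : SubdivisionAlphabet ℓ) = ⟨y 0, ⟨l, hl⟩⟩ := by
    have h := hx.apply_eq hy hu0
    rw [← imageWord_subdivision_apply hπ x 0 hk, ← imageWord_subdivision_apply hπ y 0 hl]
    simpa using h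
  have h0' : x 0 = y 0 := congrArg Sigma.fst h0
  have hkl : k = l := congrArg (fun c : SubdivisionAlphabet ℓ => (c.2 : ℕ)) h0
  subst hkl
  refine ⟨rfl, ?_⟩
  have key : ∀ n : ℕ, blockStart ℓ x n < k + u.length →
      blockStart ℓ x n = blockStart ℓ y n ∧ x n = y n := by
    intro n
    induction n with
    | zero => exact fun _ => ⟨by simp, h0'⟩
    | succ n ih =>
      intro hn
      push_cast at hn ⊢
      have hlt : blockStart ℓ x n < blockStart ℓ x (n + 1) :=
        blockStart_strictMono hπ.pos_of_subdivision x (by omega)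
      obtain ⟨h1, h2⟩ := ih (hlt.trans hn)
      have h3 : blockStart ℓ x (n + 1) = blockStart ℓ y (n + 1) := by
        rw [blockStart_add_one, blockStart_add_one, h1, h2]
      refine ⟨h3, ?_⟩
      have h4 : (k : ℤ) < blockStart ℓ x (n + 1) := by
        have h5 := (blockStart_strictMono hπ.pos_of_subdivision x).monotone
          (show (0 : ℤ) + 1 ≤ n + 1 by omega)
        rw [blockStart_add_one, blockStart_zero] at h5
        omega
      -- The letter of u at the start of block n + 1 names the letters of x and of y there.
      have h6 := hx.apply_eq hy (i := (blockStart ℓ x (n + 1) - k).toNat) (by omega)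
      rw [Int.toNat_of_nonneg (by omega), add_sub_cancel] at h6
      have hx0 := imageWord_subdivision_apply hπ x (n + 1) (hπ.pos_of_subdivision _)
      have hy0 := imageWord_subdivision_apply hπ y (n + 1) (hπ.pos_of_subdivision _)
      rw [Nat.cast_zero, add_zero] at hx0 hy0
      rw [hx0, h3, hy0] at h6
      exact congrArg Sigma.fst h6
  exact fun n hn => (key n hn).2

/-- A shortest word whose subdivision has `u` as a factor has all its blocks met by `u`. -/
theorem IsHat.exists_occursAt {u : FreeMonoid (SubdivisionAlphabet ℓ)} (hu : u ≠ 1)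
    {v : FreeMonoid A} (huv : IsHat ℓ u v) {x : ℤ → A} (hx : OccursAt v x 0) :
    ∃ k < ℓ (x 0), OccursAt u (imageWord hπ x) k ∧
      ∀ n : ℕ, n < v.length → blockStart ℓ x n < k + u.length := by
  have hu0 : 0 < u.length := Nat.pos_of_ne_zero (by simpa using hu)
  have hlen := blockStart_add_length (subdivision ℓ) hx
  have hπx := hx.map hπ
  rw [lengthFn_subdivision, blockStart_zero, zero_add, zero_add] at hlen
  rw [blockStart_zero] at hπx
  obtain ⟨i, hi, hiu⟩ := hπx.exists_of_isFactor huv.1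
  rw [zero_add] at hiu
  have hmono := blockStart_strictMono hπ.pos_of_subdivision x
  obtain ⟨j, hj, hj'⟩ := exists_block hπ.pos_of_subdivision x i
  obtain ⟨m, hm, hm'⟩ := exists_block hπ.pos_of_subdivision x (i + u.length - 1)
  have hj0 : 0 < j + 1 := hmono.lt_iff_lt.1 (by rw [blockStart_zero]; omega)
  have hjm : j < m + 1 := hmono.lt_iff_lt.1 (by omega)
  have hmv : m < v.length := hmono.lt_iff_lt.1 (by omega)
  -- The letters in blocks j, …, m, which u meets, form a competitor for v; minimality forces j = 0
  -- and m + 1 = |v|.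
  have hw := occursAt_wordAt x j (m + 1 - j).toNat
  have hwlen := blockStart_add_length (subdivision ℓ) hw
  have hπw := hw.map hπ
  rw [lengthFn_subdivision] at hwlen hπw
  rw [length_wordAt, Int.toNat_of_nonneg (by omega), add_sub_cancel] at hwlen
  have hmin := huv.2 _ (hπw.isFactor (u := u) (i := (i - blockStart ℓ x j).toNat)
    (by rwa [Int.toNat_of_nonneg (by omega), add_sub_cancel]) (by omega))
  rw [length_wordAt] at hmin
  obtain rfl : j = 0 := by omega
  refine ⟨i, ?_, hiu, fun n hn => ?_⟩
  · rw [blockStart_add_one, blockStart_zero] at hj'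
    omega
  · have := hmono.monotone (show (n : ℤ) ≤ m by omega)
    omega

theorem exists_isHat {u : FreeMonoid (SubdivisionAlphabet ℓ)} {x : ℤ → A} {k : ℤ}
    (h : OccursAt u (imageWord hπ x) k) : ∃ v, IsHat ℓ u v := by
  obtain ⟨n, hn, hn'⟩ := exists_block hπ.lengthFn_pos x k
  have hw := occursAt_wordAt x n (u.length + 1)
  have hf : IsFactor u (subdivision ℓ (wordAt x n (u.length + 1))) := by
    refine (hw.map hπ).isFactor (i := (k - blockStart (lengthFn (subdivision ℓ)) x n).toNat) ?_ ?_
    · rwa [Int.toNat_of_nonneg (by omega), add_sub_cancel]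
    · have h1 := blockStart_add_length (subdivision ℓ) hw
      have h2 := sub_le_blockStart_sub hπ.lengthFn_pos x (m := n + 1) (n := n + (u.length + 1))
        (by omega)
      rw [length_wordAt] at h1
      push_cast at h1
      omega
  obtain ⟨v, hv, hmin⟩ := (measure (FreeMonoid.length (α := A))).wf.has_min
    {v | IsFactor u (subdivision ℓ v)} ⟨_, hf⟩
  exact ⟨v, hv, fun v' hv' => not_lt.1 (hmin v' hv')⟩

-- The starting offset of u in the block of y₀ is unique, so the block sum is 0 or 1. It is 1
-- exactly when y reads v at 0, because u meets every block of v and thereby determines all its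
-- letters.
open Classical in
theorem IsHat.blockSum_eq {u : FreeMonoid (SubdivisionAlphabet ℓ)} (hu : u ≠ 1)
    {v : FreeMonoid A} (huv : IsHat ℓ u v) (y : ℤ → A) :
    blockSum hπ ({z | OccursAt u z 0}.indicator (1 : (ℤ → SubdivisionAlphabet ℓ) → ENNReal)) y =
      {z | OccursAt v z 0}.indicator (1 : (ℤ → A) → ENNReal) y := by
  unfold blockSum
  rw [lengthFn_subdivision]
  simp only [Set.indicator_apply, Set.mem_ofPred_eq, occursAt_shift, add_zero, Pi.one_apply]
  by_cases hv : OccursAt v y 0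
  · obtain ⟨k, hk, hku, -⟩ := huv.exists_occursAt hπ hu hv
    rw [if_pos hv, Finset.sum_eq_single k, if_pos hku]
    · intro l hl hlk
      exact if_neg fun hlu => hlk (eq_of_occursAt_subdivision hπ hu (Finset.mem_range.1 hl) hk
        hlu hku).1
    · exact fun h => absurd (Finset.mem_range.2 hk) h
  · rw [if_neg hv]
    refine Finset.sum_eq_zero fun l hl => if_neg fun hlu => hv ?_
    have : Nonempty A := ⟨y 0⟩
    -- A reference point reading v: as u occurs in both subdivisions, y must agree with x along v.
    obtain ⟨x, hx⟩ := MeasureTransfer.exists_occursAt v 0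
    obtain ⟨k, hk, hku, hkv⟩ := huv.exists_occursAt hπ hu hx
    obtain ⟨-, h⟩ := eq_of_occursAt_subdivision hπ hu hk (Finset.mem_range.1 hl) hku hlu
    refine hx.congr fun i hi => ?_
    rw [zero_add, h i (hkv i hi)]

theorem blockSum_eq_zero_of_forall_not_isHat {u : FreeMonoid (SubdivisionAlphabet ℓ)}
    (h : ¬∃ v, IsHat ℓ u v) (y : ℤ → A) :
    blockSum hπ ({z | OccursAt u z 0}.indicator (1 : (ℤ → SubdivisionAlphabet ℓ) → ENNReal)) y = 0 :=
  Finset.sum_eq_zero fun _ _ => Set.indicator_of_notMem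
    (fun hk => h (exists_isHat hπ (occursAt_shift.1 hk))) _

end Subdivision

/-! ### Identification of the measure transfer -/

section Identification

theorem OccursAt.map_letters {A B : Type*} {w : FreeMonoid A} {x : ℤ → A} {k : ℤ} (h : OccursAt w x k)
    (g : A → B) : OccursAt (FreeMonoid.map g w) (fun n => g (x n)) k := by
  intro i hi
  simp only [FreeMonoid.toList_map, List.getElem_map]
  rw [h i (by simpa using hi)]

theorem letterMap_imageWord {A B : Type*} {σ : FreeMonoid A →* FreeMonoid B} (hσ : NonErasing σ)
    (hπ : NonErasing (subdivision (lengthFn σ))) (x : ℤ → A) :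
    (fun n => letterMap σ (imageWord hπ x n)) = imageWord hσ x := by
  refine imageWord_unique hσ fun n => ?_
  have h := (occursAt_imageWord_of hπ x n).map_letters (letterMap σ)
  rw [lengthFn_subdivision] at h
  rwa [← MonoidHom.comp_apply, map_letterMap_comp_subdivision] at h

variable {A B : Type*} [Finite A] [TopologicalSpace A] [DiscreteTopology A]
  [MeasurableSpace A] [DiscreteMeasurableSpace A]
  [Finite B] [TopologicalSpace B] [DiscreteTopology B]
  [MeasurableSpace B] [DiscreteMeasurableSpace B]

theorem HasWeights.eq {ω : FreeMonoid A → ℝ≥0} {ν ν' : FiniteMeasure (ℤ → A)}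
    (h : HasWeights ω ν) (h' : HasWeights ω ν') : ν = ν' := by
  refine FiniteMeasure.toMeasure_injective (eq_of_cylinder_eq h.1.1 h'.1.1 fun w hw => ?_)
  have := (h.2 w hw).trans (h'.2 w hw).symm
  rw [← ENNReal.coe_inj, FiniteMeasure.ennreal_coeFn_eq_coeFn_toMeasure,
    FiniteMeasure.ennreal_coeFn_eq_coeFn_toMeasure] at this
  exact this

theorem HasWeights.measureOfWeights_eq {ω : FreeMonoid A → ℝ≥0} {ν : FiniteMeasure (ℤ → A)}
    (h : HasWeights ω ν) : measureOfWeights ω = ν := by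
  have hex : ∃ ν : FiniteMeasure (ℤ → A), HasWeights ω ν := ⟨ν, h⟩
  rw [measureOfWeights, dif_pos hex]
  exact hex.choose_spec.eq h

theorem hasWeights_transfer_subdivision {ℓ : A → ℕ} (hπ : NonErasing (subdivision ℓ))
    {μ : FiniteMeasure (ℤ → A)} (hμ : MeasurePreserving (shift (1 : ℤ)) (μ : Measure (ℤ → A)) μ) :
    HasWeights (subdivisionWeight ℓ μ) (transfer hπ μ) := by
  have hT := measurePreserving_transferMeasure hπ hμ
  refine ⟨⟨hT, Set.subset_univ _⟩, fun u hu => ?_⟩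
  -- Cylinders are read from position 1 but blocks are counted from 0; invariance moves the cylinder
  -- to 0.
  rw [← ENNReal.coe_inj, FiniteMeasure.ennreal_coeFn_eq_coeFn_toMeasure, toMeasure_transfer,
    ← measure_occursAt_eq hT u 0, transferMeasure_apply _ _ (measurableSet_occursAt u 0),
    subdivisionWeight]
  split_ifs with h
  · simp_rw [h.choose_spec.blockSum_eq hπ hu]
    rw [lintegral_indicator_one (measurableSet_occursAt _ 0), measure_occursAt_eq hμ,
      FiniteMeasure.ennreal_coeFn_eq_coeFn_toMeasure]
  · simp_rw [blockSum_eq_zero_of_forall_not_isHat hπ h]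
    simp

theorem measureTransfer_eq_transfer {σ : FreeMonoid A →* FreeMonoid B} (hσ : NonErasing σ)
    {μ : FiniteMeasure (ℤ → A)} (hμ : MeasurePreserving (shift (1 : ℤ)) (μ : Measure (ℤ → A)) μ) :
    measureTransfer σ μ = transfer hσ μ := by
  have hπ : NonErasing (subdivision (lengthFn σ)) := nonErasing_subdivision hσ.lengthFn_pos
  have hg : Measurable fun (x : ℤ → SubdivisionAlphabet (lengthFn σ)) n => letterMap σ (x n) :=
    measurable_pi_lambda _ fun n => (Measurable.of_discrete (f := letterMap σ)).comp (measurable_pi_apply n)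
  rw [measureTransfer, subdivisionMeasure,
    (hasWeights_transfer_subdivision hπ hμ).measureOfWeights_eq]
  refine FiniteMeasure.toMeasure_injective (Measure.ext fun s hs => ?_)
  rw [FiniteMeasure.toMeasure_map, Measure.map_apply hg hs, toMeasure_transfer,
    toMeasure_transfer, transferMeasure_apply _ _ (hg hs), transferMeasure_apply _ _ hs]
  refine lintegral_congr fun x => ?_
  unfold blockSum
  rw [lengthFn_subdivision, ← letterMap_imageWord hσ hπ]
  rfl

end Identification

end MeasureTransfer

namespace MeasureTransfer

/-! ### Positive functionals and measures -/

section Functional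

variable {Ω : Type*} [TopologicalSpace Ω] [CompactSpace Ω] [MeasurableSpace Ω] [BorelSpace Ω]

theorem integrable_continuousMap (μ : Measure Ω) [IsFiniteMeasure μ] (f : C(Ω, ℝ)) :
    Integrable f μ :=
  (BoundedContinuousFunction.mkOfCompact f).integrable μ

/-- The Riesz–Markov–Kakutani theorem on a compact space. -/
theorem exists_measure_of_nonneg [T2Space Ω] (Λ : C(Ω, ℝ) →ₗ[ℝ] ℝ)
    (hΛ : ∀ f : C(Ω, ℝ), 0 ≤ f → 0 ≤ Λ f) :
    ∃ μ : Measure Ω, IsFiniteMeasure μ ∧ ∀ f : C(Ω, ℝ), ∫ x, f x ∂μ = Λ f := by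
  let Λ' : CompactlySupportedContinuousMap Ω ℝ →ₗ[ℝ] ℝ :=
    { toFun := fun f => Λ f.toContinuousMap
      map_add' := fun f g => Λ.map_add f.toContinuousMap g.toContinuousMap
      map_smul' := fun c f => Λ.map_smul c f.toContinuousMap }
  let P := PositiveLinearMap.mk₀ Λ' fun f hf => hΛ f.toContinuousMap hf
  refine ⟨RealRMK.rieszMeasure P, inferInstance, fun f => ?_⟩
  exact RealRMK.integral_rieszMeasure P (CompactlySupportedContinuousMap.continuousMapEquiv f)

/-- The M. Riesz extension theorem for continuous functions on a compact space: a functional that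
is given on the range of a linear map and is non-negative there on the functions that are
non-negative on `X` is given by a measure, whose integrals are non-negative on such functions. -/
theorem exists_measure_of_range [T2Space Ω] (X : Set Ω) {V : Type*} [AddCommGroup V] [Module ℝ V]
    (Φ : V →ₗ[ℝ] C(Ω, ℝ)) (ψ : V →ₗ[ℝ] ℝ)
    (hpos : ∀ v, (∀ x ∈ X, 0 ≤ Φ v x) → 0 ≤ ψ v)
    (hone : ∃ v, ∀ x, 1 ≤ Φ v x) :
    ∃ μ : Measure Ω, IsFiniteMeasure μ ∧ (∀ v, ∫ x, Φ v x ∂μ = ψ v) ∧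
      ∀ f : C(Ω, ℝ), (∀ x ∈ X, 0 ≤ f x) → 0 ≤ ∫ x, f x ∂μ := by
  -- Positivity applied to v and −v makes ψ vanish on the kernel of Φ, so ψ factors through the
  -- range.
  have hker : ψ ∈ (LinearMap.ker Φ).dualAnnihilator := by
    rw [Submodule.mem_dualAnnihilator]
    intro v hv
    rw [LinearMap.mem_ker] at hv
    have h1 := hpos v (by simp [hv])
    have h2 := hpos (-v) (by simp [hv])
    rw [map_neg] at h2
    linarith
  rw [← LinearMap.range_dualMap_eq_dualAnnihilator_ker] at hker
  obtain ⟨ψ', hψ'⟩ := hker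
  have hψ : ∀ v, ψ' (Φ v) = ψ v := fun v => by rw [← hψ']; rfl
  let s : PointedCone ℝ C(Ω, ℝ) :=
    { carrier := {f | ∀ x ∈ X, 0 ≤ f x}
      add_mem' := fun hf hg x hx => add_nonneg (hf x hx) (hg x hx)
      zero_mem' := fun x _ => le_rfl
      smul_mem' := fun c _ hf x hx => mul_nonneg c.2 (hf x hx) }
  obtain ⟨Λ, hΛ, hΛs⟩ := riesz_extension s
    ⟨LinearMap.range Φ, ψ'.domRestrict (LinearMap.range Φ)⟩ (by
      rintro ⟨_, v, rfl⟩ h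
      change 0 ≤ ψ' (Φ v)
      rw [hψ]
      exact hpos v h) (by
      intro f
      obtain ⟨v, hv⟩ := hone
      -- Cofinality of the range: Φ v ≥ 1, so ‖f‖ • Φ v dominates −f.
      refine ⟨⟨Φ (‖f‖ • v), _, rfl⟩, fun x _ => ?_⟩
      have h1 := f.norm_coe_le_norm x
      have h2 : ‖f‖ * 1 ≤ ‖f‖ * Φ v x := mul_le_mul_of_nonneg_left (hv x) (norm_nonneg _)
      have h3 := neg_abs_le (f x)
      rw [Real.norm_eq_abs] at h1
      simp only [map_smul, ContinuousMap.add_apply, ContinuousMap.smul_apply, smul_eq_mul]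
      linarith)
  obtain ⟨μ, hμ, hμΛ⟩ := exists_measure_of_nonneg Λ fun f hf => hΛs f fun x _ => hf x
  refine ⟨μ, hμ, fun v => ?_, fun f hf => ?_⟩
  · rw [hμΛ, hΛ ⟨Φ v, v, rfl⟩]
    exact hψ v
  · rw [hμΛ]
    exact hΛs f hf

end Functional

/-! ### Lifting invariant measures -/

section Lifting

theorem abs_sum_range_le {Ω : Type*} [TopologicalSpace Ω] [CompactSpace Ω] (f : C(Ω, ℝ))
    (g : ℕ → Ω) (m : ℕ) : |∑ k ∈ Finset.range m, f (g k)| ≤ m * ‖f‖ := by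
  refine (Finset.abs_sum_le_sum_abs _ _).trans ?_
  refine (Finset.sum_le_card_nsmul _ _ ‖f‖ fun k _ => f.norm_coe_le_norm (g k)).trans ?_
  simp

/-- If the block sums of `f` are non-negative on `X` up to a coboundary, then the Birkhoff sums of
`f` are bounded from below on the orbit image of `X`. -/
theorem exists_le_sum_of_blockSum_nonneg {A B : Type*} [Finite A] [TopologicalSpace A]
    [Finite B] [TopologicalSpace B] {σ : FreeMonoid A →* FreeMonoid B} (hσ : NonErasing σ)
    {X : Set (ℤ → A)} (hXT : shift (1 : ℤ) '' X = X)
    (f : C(ℤ → B, ℝ)) (h : C(ℤ → A, ℝ))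
    (hf : ∀ x ∈ X, 0 ≤ blockSum hσ f x + (h (shift (1 : ℤ) x) - h x)) :
    ∃ c : ℝ, ∀ y ∈ orbitImage hσ X, ∀ N : ℕ,
      c ≤ ∑ k ∈ Finset.range N, f (shift (k : ℤ) y) := by
  obtain ⟨K, hK⟩ := exists_lengthFn_le σ
  -- The telescoped coboundary costs 2‖h‖, and the incomplete blocks at the two ends cost at most
  -- K‖f‖ each.
  refine ⟨-(2 * ‖h‖ + 2 * (K * ‖f‖)), ?_⟩
  rintro _ ⟨m, x', hx', rfl⟩ N
  obtain ⟨j', j, hj, hjm⟩ := exists_shift_imageWord_eq hσ x' m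
  rw [hjm]
  have hx := shift_mem_of_image_shift hXT hx' j'
  generalize shift j' x' = x at hj hx ⊢
  obtain ⟨n', hn, hn'⟩ := exists_block hσ.lengthFn_pos x ((j + N : ℕ) : ℤ)
  have hmono := blockStart_strictMono hσ.lengthFn_pos x
  have hn0 : 0 < n' + 1 := hmono.lt_iff_lt.1 (by rw [blockStart_zero]; omega)
  obtain ⟨n, rfl⟩ := Int.eq_ofNat_of_zero_le (show 0 ≤ n' by omega)
  have hL0 := hmono.monotone (show (0 : ℤ) ≤ n by omega)
  rw [blockStart_zero] at hL0
  obtain ⟨L, hL⟩ := Int.eq_ofNat_of_zero_le hL0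
  rw [blockStart_add_one, hL] at hn'
  rw [hL] at hn
  have hKn := hK (x n)
  have hKj := hK (x 0)
  obtain ⟨r, hr⟩ : ∃ r, j + N = L + r := Nat.exists_eq_add_of_le (by omega)
  have hblocks : -(2 * ‖h‖) ≤ ∑ k ∈ Finset.range L, f (shift (k : ℤ) (imageWord hσ x)) := by
    rw [sum_range_blockStart hσ f x n L hL]
    have h1 : ∑ i ∈ Finset.range n, (h (shift (i : ℤ) x) - h (shift ((i + 1 : ℕ) : ℤ) x)) ≤
        ∑ i ∈ Finset.range n, blockSum hσ f (shift (i : ℤ) x) := by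
      refine Finset.sum_le_sum fun i _ => ?_
      have := hf _ (shift_mem_of_image_shift hXT hx i)
      rw [← shift_add] at this
      push_cast
      linarith
    rw [Finset.sum_range_sub'] at h1
    have h2 := (abs_le.1 (h.norm_coe_le_norm (shift ((0 : ℕ) : ℤ) x))).1
    have h3 := (abs_le.1 (h.norm_coe_le_norm (shift (n : ℤ) x))).2
    linarith
  -- The window of length N starts j places into the first block and ends r places into block n;
  -- adding the first j terms leaves complete blocks and a remainder.
  have hsplit : ∑ k ∈ Finset.range j, f (shift (k : ℤ) (imageWord hσ x)) +
      ∑ k ∈ Finset.range N, f (shift (k : ℤ) (shift (j : ℤ) (imageWord hσ x))) =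
        ∑ k ∈ Finset.range L, f (shift (k : ℤ) (imageWord hσ x)) +
        ∑ k ∈ Finset.range r, f (shift ((L + k : ℕ) : ℤ) (imageWord hσ x)) := by
    rw [← Finset.sum_range_add (fun k : ℕ => f (shift (k : ℤ) (imageWord hσ x))), ← hr,
      Finset.sum_range_add]
    simp only [← shift_add, Nat.cast_add]
  have hbound : ∀ t : ℕ, t ≤ K → (t : ℝ) * ‖f‖ ≤ K * ‖f‖ := fun t ht =>
    mul_le_mul_of_nonneg_right (Nat.cast_le.2 ht) (norm_nonneg _)
  have h4 := (abs_le.1 (abs_sum_range_le f (fun k => shift (k : ℤ) (imageWord hσ x)) j)).2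
  have h5 := (abs_le.1 (abs_sum_range_le f
    (fun k => shift ((L + k : ℕ) : ℤ) (imageWord hσ x)) r)).1
  have h6 := hbound j (by omega)
  have h7 := hbound r (by omega)
  linarith

variable {A B : Type*} [Finite A] [TopologicalSpace A] [DiscreteTopology A]
  [Finite B] [TopologicalSpace B] [DiscreteTopology B]
  {σ : FreeMonoid A →* FreeMonoid B} (hσ : NonErasing σ)

/-- The block sum of a continuous function, as a linear map. -/
noncomputable def blockSumLinear : C(ℤ → B, ℝ) →ₗ[ℝ] C(ℤ → A, ℝ) where
  toFun f := ⟨blockSum hσ f, continuous_blockSum hσ f.continuous⟩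
  map_add' f g := by
    ext x
    simp [blockSum, Finset.sum_add_distrib]
  map_smul' c f := by
    ext x
    simp [blockSum, Finset.mul_sum]

/-- The coboundary of a continuous function, as a linear map. -/
noncomputable def coboundaryLinear (A : Type*) [TopologicalSpace A] :
    C(ℤ → A, ℝ) →ₗ[ℝ] C(ℤ → A, ℝ) where
  toFun f := f.comp ⟨shift (1 : ℤ), continuous_shift 1⟩ - f
  map_add' f g := by
    ext x
    simp
    ring
  map_smul' c f := by
    ext x
    simp [mul_sub]

variable [MeasurableSpace A] [DiscreteMeasurableSpace A]
  [MeasurableSpace B] [DiscreteMeasurableSpace B]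

theorem integral_shift {ν : Measure (ℤ → B)} (hν : MeasurePreserving (shift (1 : ℤ)) ν ν)
    (f : C(ℤ → B, ℝ)) (k : ℕ) : ∫ y, f (shift (k : ℤ) y) ∂ν = ∫ y, f y ∂ν := by
  induction k with
  | zero => simp
  | succ k ih =>
    have hg : Continuous fun y => f (shift (k : ℤ) y) := f.continuous.comp (continuous_shift _)
    rw [← ih]
    conv_rhs => rw [← hν.map_eq]
    rw [integral_map hν.measurable.aemeasurable hg.aestronglyMeasurable]
    simp only [← shift_add, Nat.cast_succ, add_comm]

/-- By invariance the Birkhoff sum of length N has integral N ∫ f dν; a bound below independent of N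
rules out a negative integral. -/
theorem integral_nonneg_of_le_sum {ν : Measure (ℤ → B)} [IsFiniteMeasure ν]
    (hν : MeasurePreserving (shift (1 : ℤ)) ν ν) {f : C(ℤ → B, ℝ)} {c : ℝ}
    (h : ∀ᵐ y ∂ν, ∀ N : ℕ, c ≤ ∑ k ∈ Finset.range N, f (shift (k : ℤ) y)) :
    0 ≤ ∫ y, f y ∂ν := by
  have key : ∀ N : ℕ, ν.real Set.univ * c ≤ N * ∫ y, f y ∂ν := fun N => by
    have hint : ∀ k : ℕ, Integrable (fun y => f (shift (k : ℤ) y)) ν := fun k =>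
      integrable_continuousMap ν (f.comp ⟨shift (k : ℤ), continuous_shift _⟩)
    calc ν.real Set.univ * c = ∫ _, c ∂ν := by simp
      _ ≤ ∫ y, ∑ k ∈ Finset.range N, f (shift (k : ℤ) y) ∂ν := by
        refine integral_mono_ae (integrable_const c) (integrable_finsetSum _ fun k _ => hint k) ?_
        filter_upwards [h] with y hy using hy N
      _ = N * ∫ y, f y ∂ν := by
        rw [integral_finsetSum _ fun k _ => hint k]
        simp [integral_shift hν]
  by_contra! hneg
  obtain ⟨N, hN⟩ := exists_nat_gt (ν.real Set.univ * c / ∫ y, f y ∂ν)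
  rw [div_lt_iff_of_neg hneg] at hN
  exact absurd (key N) (not_le.2 hN)

/-- A clopen cylinder around a support point outside X can avoid X. Minus its indicator is
continuous and vanishes on X, yet has negative integral. -/
theorem support_subset_of_integral_nonneg {X : Set (ℤ → A)} (hX : IsClosed X)
    {μ : Measure (ℤ → A)} [IsFiniteMeasure μ]
    (h : ∀ f : C(ℤ → A, ℝ), (∀ x ∈ X, 0 ≤ f x) → 0 ≤ ∫ x, f x ∂μ) : μ.support ⊆ X := by
  intro x hx
  by_contra hxX
  obtain ⟨N, hN⟩ := exists_centralCylinder_subset (hX.isOpen_compl.mem_nhds hxX)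
  have hclopen : IsClopen (centralCylinder x N) := by
    rw [centralCylinder_eq]
    exact isClopen_occursAt _ _
  let g : C(ℤ → A, ℝ) := -(LocallyConstant.charFn ℝ hclopen : C(ℤ → A, ℝ))
  have hg : ∀ z, g z = -(centralCylinder x N).indicator 1 z := fun z => by
    simp [g, LocallyConstant.coe_charFn]
  have hpos := h g fun z hz => by
    rw [hg, Set.indicator_of_notMem fun hzN => hN hzN hz, neg_zero]
  simp_rw [hg] at hpos
  rw [integral_neg, integral_indicator_one hclopen.isOpen.measurableSet] at hpos
  have hμ := (Measure.mem_support_iff_forall x).1 hx _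
    ((isOpen_centralCylinder x N).mem_nhds (mem_centralCylinder_self x N))
  have := ENNReal.toReal_pos hμ.ne' (measure_ne_top _ _)
  rw [← measureReal_def] at this
  linarith

theorem exists_transfer_eq {X : Set (ℤ → A)} (hX : IsClosed X) (hXT : shift (1 : ℤ) '' X = X)
    {ν : FiniteMeasure (ℤ → B)} (hν : ν ∈ invariantMeasures (imageSubshift σ X)) :
    ∃ μ ∈ invariantMeasures X, transfer hσ μ = ν := by
  obtain ⟨hνT, hνX⟩ := hν
  rw [imageSubshift_eq_orbitImage hσ hX hXT] at hνX
  -- The second component is ignored: sending coboundaries to zero is what makes the extended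
  -- measure invariant.
  let ψ : C(ℤ → B, ℝ) × C(ℤ → A, ℝ) →ₗ[ℝ] ℝ :=
    { toFun := fun v => ∫ y, v.1 y ∂(ν : Measure (ℤ → B))
      map_add' := fun v w =>
        integral_add (integrable_continuousMap _ v.1) (integrable_continuousMap _ w.1)
      map_smul' := fun c v => integral_const_mul c _ }
  obtain ⟨μ, hμ, hμΦ, hμX⟩ := exists_measure_of_range X
    ((blockSumLinear hσ).coprod (coboundaryLinear A)) ψ (by
      rintro ⟨f, h⟩ hfh
      obtain ⟨c, hc⟩ := exists_le_sum_of_blockSum_nonneg hσ hXT f h hfh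
      refine integral_nonneg_of_le_sum (c := c) hνT ?_
      filter_upwards [Measure.support_mem_ae (μ := (ν : Measure (ℤ → B)))] with y hy
      exact hc y (hνX hy)) (by
      -- The block sum of the constant 1 is |σ(x₀)| ≥ 1.
      refine ⟨(1, 0), fun x => ?_⟩
      have := hσ.lengthFn_pos (x 0)
      simpa [blockSumLinear, blockSum] using Nat.succ_le_of_lt this)
  have hμT : MeasurePreserving (shift (1 : ℤ)) μ μ := by
    refine ⟨measurable_shift 1, ?_⟩
    have : IsFiniteMeasure (μ.map (shift (1 : ℤ))) := inferInstance
    refine ext_of_forall_integral_eq_of_IsFiniteMeasure fun f => ?_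
    rw [integral_map (measurable_shift 1).aemeasurable f.continuous.aestronglyMeasurable]
    have h := hμΦ (0, f.toContinuousMap)
    have h0 : ψ (0, f.toContinuousMap) = 0 := integral_zero _ _
    rw [h0, LinearMap.coprod_apply, map_zero, zero_add] at h
    change ∫ x, (f (shift (1 : ℤ) x) - f x) ∂μ = 0 at h
    rwa [integral_sub, sub_eq_zero] at h
    · exact integrable_continuousMap μ
        (f.toContinuousMap.comp ⟨shift (1 : ℤ), continuous_shift _⟩)
    · exact integrable_continuousMap μ f.toContinuousMap
  obtain ⟨μ, rfl⟩ : ∃ μ' : FiniteMeasure (ℤ → A), (μ' : Measure (ℤ → A)) = μ := ⟨⟨μ, hμ⟩, rfl⟩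
  refine ⟨μ, ⟨hμT, support_subset_of_integral_nonneg hX hμX⟩, ?_⟩
  refine FiniteMeasure.toMeasure_injective ?_
  refine ext_of_forall_lintegral_eq_of_IsFiniteMeasure fun f => ?_
  let g : BoundedContinuousFunction (ℤ → A) ℝ≥0 := BoundedContinuousFunction.mkOfCompact
    ⟨blockSum hσ f, continuous_blockSum hσ f.continuous⟩
  have hg : ∀ x, blockSum hσ (fun y => (f y : ENNReal)) x = (g x : ENNReal) := fun x => by
    simp [g, blockSum]
  rw [toMeasure_transfer, lintegral_transferMeasure hσ _ f.measurable_coe_ennreal_comp]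
  simp_rw [hg]
  refine (ENNReal.toReal_eq_toReal_iff' (BoundedContinuousFunction.lintegral_lt_top_of_nnreal _ g).ne
    (BoundedContinuousFunction.lintegral_lt_top_of_nnreal _ f).ne).1 ?_
  rw [BoundedContinuousFunction.toReal_lintegral_coe_eq_integral,
    BoundedContinuousFunction.toReal_lintegral_coe_eq_integral]
  have h := hμΦ (⟨fun y => (f y : ℝ), by fun_prop⟩, 0)
  rw [LinearMap.coprod_apply, map_zero, add_zero] at h
  refine Eq.trans (integral_congr_ae (Filter.Eventually.of_forall fun x => ?_)) h
  simp [g, blockSumLinear, blockSum]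

end Lifting

end MeasureTransfer

namespace MeasureTransfer

/-! ### Linearity of the transfer and its restriction to invariant measures -/

section Linear

variable {A B : Type*} [Finite A] [TopologicalSpace A] [DiscreteTopology A]
  [MeasurableSpace A] [DiscreteMeasurableSpace A]
  [Finite B] [TopologicalSpace B] [DiscreteTopology B]
  [MeasurableSpace B] [DiscreteMeasurableSpace B]
  {σ : FreeMonoid A →* FreeMonoid B} (hσ : NonErasing σ)

theorem transfer_add (μ ν : FiniteMeasure (ℤ → A)) :
    transfer hσ (μ + ν) = transfer hσ μ + transfer hσ ν := by
  refine FiniteMeasure.toMeasure_injective ?_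
  rw [FiniteMeasure.toMeasure_add, toMeasure_transfer, toMeasure_transfer, toMeasure_transfer,
    FiniteMeasure.toMeasure_add, transferMeasure_add]

theorem transfer_smul (c : ℝ≥0) (μ : FiniteMeasure (ℤ → A)) :
    transfer hσ (c • μ) = c • transfer hσ μ := by
  refine FiniteMeasure.toMeasure_injective ?_
  rw [FiniteMeasure.toMeasure_smul, toMeasure_transfer, toMeasure_transfer,
    FiniteMeasure.toMeasure_smul, transferMeasure_smul]

/-- The transfer of finite measures as a linear map. -/
noncomputable def transferLinear :
    FiniteMeasure (ℤ → A) →ₗ[ℝ≥0] FiniteMeasure (ℤ → B) where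
  toFun := transfer hσ
  map_add' := transfer_add hσ
  map_smul' := transfer_smul hσ

/-- The transfer of invariant measures on `X` as a linear map. -/
noncomputable def transferInvariant (X : Set (ℤ → A)) :
    invariantMeasures X →ₗ[ℝ≥0] invariantMeasures (imageSubshift σ X) :=
  (transferLinear hσ).restrict fun _ hμ => transfer_mem_invariantMeasures hσ hμ

end Linear

end MeasureTransfer

open MeasureTransfer in
theorem proposition1p3 {A B : Type*}
    [Finite A] [TopologicalSpace A] [DiscreteTopology A]
    [MeasurableSpace A] [DiscreteMeasurableSpace A]
    [Finite B] [TopologicalSpace B] [DiscreteTopology B]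
    [MeasurableSpace B] [DiscreteMeasurableSpace B]
    (σ : FreeMonoid A →* FreeMonoid B) (hσ : NonErasing σ)
    (X : Set (ℤ → A)) (hX : IsSubshift X) :
    -- the subdivision measure, hence the transferred measure, is well defined
    (∀ μ ∈ invariantMeasures (Set.univ : Set (ℤ → A)),
      ∃! ν : FiniteMeasure (ℤ → SubdivisionAlphabet (lengthFn σ)),
        HasWeights (subdivisionWeight (lengthFn σ) μ) ν) ∧
    -- `σ(X)` is a subshift
    IsSubshift (imageSubshift σ X) ∧
    -- the transfer restricts to an `ℝ≥0`-linear map `M(X) → M(σ(X))`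
    ∃ f : invariantMeasures X →ₗ[ℝ≥0] invariantMeasures (imageSubshift σ X),
      (∀ μ : invariantMeasures X,
        (f μ : FiniteMeasure (ℤ → B)) = measureTransfer σ (μ : FiniteMeasure (ℤ → A))) ∧
      Continuous f ∧
      Function.Surjective f ∧
      -- functoriality
      (∀ (C : Type*) [Finite C] [TopologicalSpace C] [DiscreteTopology C]
        [MeasurableSpace C] [DiscreteMeasurableSpace C]
        (σ' : FreeMonoid B →* FreeMonoid C), NonErasing σ' →
        imageSubshift (σ'.comp σ) X = imageSubshift σ' (imageSubshift σ X) ∧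
        ∀ μ : invariantMeasures X,
          measureTransfer (σ'.comp σ) (μ : FiniteMeasure (ℤ → A)) =
            measureTransfer σ' (f μ : FiniteMeasure (ℤ → B))) ∧
      -- supports
      (∀ X' : Set (ℤ → A), IsSubshift X' → X' ⊆ X → ∀ μ : invariantMeasures X,
        ((μ : FiniteMeasure (ℤ → A)) : Measure (ℤ → A)).support = X' →
        ((f μ : FiniteMeasure (ℤ → B)) : Measure (ℤ → B)).support = imageSubshift σ X') := by
  have hinv : ∀ {Y : Set (ℤ → A)} (μ : invariantMeasures Y), MeasurePreserving (shift (1 : ℤ))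
      ((μ : FiniteMeasure (ℤ → A)) : Measure (ℤ → A)) (μ : FiniteMeasure (ℤ → A)) := fun μ => μ.2.1
  refine ⟨fun μ hμ => ?_, isSubshift_imageSubshift hX hσ, transferInvariant hσ X, fun μ => ?_, ?_,
    fun ν => ?_, fun C _ _ _ _ _ σ' hσ' => ⟨?_, fun μ => ?_⟩, fun X' _ _ μ hμ => ?_⟩
  · have h := hasWeights_transfer_subdivision (nonErasing_subdivision hσ.lengthFn_pos) hμ.1
    exact ⟨_, h, fun ν hν => hν.eq h⟩
  · exact (measureTransfer_eq_transfer hσ (hinv μ)).symm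
  · exact ((continuous_transfer hσ).comp continuous_subtype_val).subtype_mk _
  · obtain ⟨μ, hμ, h⟩ := exists_transfer_eq hσ hX.isClosed hX.image_shift ν.2
    exact ⟨⟨μ, hμ⟩, Subtype.ext h⟩
  · have hY := isSubshift_imageSubshift hX hσ
    rw [imageSubshift_eq_orbitImage hσ' hY.isClosed hY.image_shift,
      imageSubshift_eq_orbitImage hσ hX.isClosed hX.image_shift,
      imageSubshift_eq_orbitImage (hσ'.comp hσ) hX.isClosed hX.image_shift,
      orbitImage_comp hσ hσ']
  · rw [measureTransfer_eq_transfer (hσ'.comp hσ) (hinv μ),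
      measureTransfer_eq_transfer hσ' (transferInvariant hσ X μ).2.1]
    exact FiniteMeasure.toMeasure_injective (transferMeasure_comp hσ hσ' _)
  · rw [← hμ]
    exact support_transferMeasure_eq_imageSubshift hσ (hinv μ)
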